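/- Let $d_X,d_Y\ge 0$ be integers, let $V\sim P_V$ be a random variable with values in a measurable space $\mathcal V$, and let $v\mapsto A_v$ be a measurable map from $\mathcal V$ to the real $d_Y\times d_X$ matrices with $\|A_v\|_{\mathrm{op}}\le 1$ for all $v$. For a probability measure $Q_X$ on $\mathbb R^{d_X}$ let $Q_{Y|V=v}$ denote the law of $Y=A_vX+Z_v$, where $X\sim Q_X$ and $Z_v\sim\mathcal N(0,I-A_vA_v^{\top})$ are independent. Let $s^\star:=\|\mathbb E_V[A_V^{\top}A_V]\|_{\mathrm{op}}$ be the largest eigenvalue of $\mathbb E_V[A_V^\top A_V]$ (with $s^\star=0$ if $d_X=0$), let $s\ge s^\star$ be a real number (for instance $s=s^\star$), and let $\delta>0$. Define $$g_\delta(Q_X):=s\,D_{\mathrm{KL}}\big(Q_X\,\big\|\,\mathcal N(0,I_{d_X})\big)-\mathbb E_{V\sim P_V}\Big[D_{\mathrm{KL}}\big(Q_{Y|V}*\mathcal N(0,\delta I_{d_Y})\,\big\|\,\mathcal N(0,I_{d_Y})\big)\Big]\in(-\infty,+\infty]$$ for $Q_X$ with finite second moment (the subtracted term is then finite; $0\cdot\infty=0$).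 Let $Q_X^{(i)}$, $i\in\mathbb N$, be probability measures on $\mathbb R^{d_X}$ converging weakly to a probability measure $Q_X^*$, and suppose that there is $b>0$ with $\mathbb E_{Q^{(i)}}[\|X\|^2]<b$ for all $i$. Then $$\liminf_{i\to\infty} g_\delta(Q_X^{(i)})\ \ge\ g_\delta(Q_X^{*}).$$ -/

import Mathlib

open MeasureTheory ProbabilityTheory InformationTheory Filter Topology
open scoped ENNReal Matrix Matrix.Norms.L2Operator

noncomputable section

namespace SmoothedFunctional

variable {𝒱 : Type*} [MeasurableSpace 𝒱] {dX dY : ℕ}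

/-- The matrix `E_V[A_Vᵀ A_V]`, entry by entry. -/
def meanGram (PV : Measure 𝒱) (A : 𝒱 → Matrix (Fin dY) (Fin dX) ℝ) :
    Matrix (Fin dX) (Fin dX) ℝ :=
  Matrix.of fun i j => ∫ v, ((A v)ᵀ * A v) i j ∂PV

/-- The constant `s⋆`: the spectral norm of `E_V[A_Vᵀ A_V]`. This matrix is positive semidefinite,
so `s⋆` is its largest eigenvalue, the least `s ≥ 0` with `s I - E_V[A_Vᵀ A_V] ⪰ 0`. (The norm on
matrices is the `ℓ²` operator norm.) -/
def sStar (PV : Measure 𝒱) (A : 𝒱 → Matrix (Fin dY) (Fin dX) ℝ) : ℝ :=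
  ‖meanGram PV A‖

/-- For a matrix `A` with `‖A‖ ≤ 1`, the law of `Y = A X + Z`, where `X ∼ Q` and
`Z ∼ N(0, I - A Aᵀ)` are independent. -/
def outputLaw (A : Matrix (Fin dY) (Fin dX) ℝ) (Q : Measure (EuclideanSpace ℝ (Fin dX))) :
    Measure (EuclideanSpace ℝ (Fin dY)) :=
  (Q.map fun x => WithLp.toLp 2 (A *ᵥ x.ofLp)) ∗ multivariateGaussian 0 (1 - A * Aᵀ)

/-- The law of `Y + √δ W`, with `W ∼ N(0, I)` independent of `Y`. -/
def smoothedOutputLaw (δ : ℝ) (A : Matrix (Fin dY) (Fin dX) ℝ)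
    (Q : Measure (EuclideanSpace ℝ (Fin dX))) : Measure (EuclideanSpace ℝ (Fin dY)) :=
  outputLaw A Q ∗ multivariateGaussian 0 (δ • (1 : Matrix (Fin dY) (Fin dY) ℝ))

/-- The conditional divergence `D(Q_{Y|V} ∗ N(0, δ I) ‖ N(0, I) | P_V)`. -/
def outputDiv (PV : Measure 𝒱) (A : 𝒱 → Matrix (Fin dY) (Fin dX) ℝ) (δ : ℝ)
    (Q : Measure (EuclideanSpace ℝ (Fin dX))) : ℝ≥0∞ :=
  ∫⁻ v, klDiv (smoothedOutputLaw δ (A v) Q) (stdGaussian (EuclideanSpace ℝ (Fin dY))) ∂PV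

/-- `g_δ(Q) = s D(Q ‖ N(0, I)) - D(Q_{Y|V} ∗ N(0, δ I) ‖ N(0, I) | P_V)`, as an extended real. For
`δ > 0` and `Q` with finite second moment the subtracted term is finite, so there is no `∞ - ∞`. -/
def gDelta (PV : Measure 𝒱) (A : 𝒱 → Matrix (Fin dY) (Fin dX) ℝ) (s δ : ℝ)
    (Q : Measure (EuclideanSpace ℝ (Fin dX))) : EReal :=
  (s : EReal) * (klDiv Q (stdGaussian (EuclideanSpace ℝ (Fin dX))) : EReal)
    - (outputDiv PV A δ Q : EReal)

end SmoothedFunctional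

end

/-! Neither divergence can be treated alone: the subtracted one carries the wrong sign, and second
moments are not weakly continuous under a mere bound. The remedy is to split off every second moment
and let them recombine with a favourable sign. For an output smoothed by `N(0, δ I)`, the divergence
plus a nonnegative entropy deficit equals a constant plus half the second moment
(`klDiv_conv_add_lintegral_deficit`). The density of the smoothed output is an integral of a bounded
continuous kernel, so it converges pointwise, and Fatou makes the deficit weakly lower
semicontinuous, also after averaging over `v`. On the input side, replacing `N(0, I)` by `N(0, ε⁻¹
I)` in the divergence releases `(1 - ε) / 2` times the second moment
(`klDiv_add_log_eq_klDiv_tilted_add`); the value `ε = 0` is excluded because the reference measure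
must stay finite. Up to a finite constant, `g_δ` is then `s D(Q ‖ N(0, ε⁻¹ I))`, plus `E[s ‖X‖² -
⟨X, E[AᵀA] X⟩] / 2`, plus the mean deficit, minus `s ε E‖X‖² / 2`. The quadratic integrand is
continuous and nonnegative exactly because `s` dominates `E[AᵀA]`, so the first three terms are
lower semicontinuous (`lscPart_le_liminf`). The last is at most `s ε b / 2` along the sequence and
vanishes as `ε → 0`. -/

namespace SmoothedFunctional

/-! ### Donsker–Varadhan duality and weak lower semicontinuity of the divergence -/

section KLSemicontinuity

/-- Fenchel–Young: `t ↦ exp t - 1` is the convex conjugate of `klFun`. It reduces to `1 + u ≤ exp u`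
at `u = t - log x`, multiplied by `x`. -/
lemma mul_sub_exp_le_klFun {x : ℝ} (hx : 0 ≤ x) (t : ℝ) :
    t * x - (Real.exp t - 1) ≤ klFun x := by
  rw [klFun_apply]
  rcases hx.eq_or_lt with rfl | hx
  · have := Real.exp_pos t
    simp; linarith
  · have h1 := Real.add_one_le_exp (t - Real.log x)
    have h2 : Real.exp t = x * Real.exp (t - Real.log x) := by
      rw [Real.exp_sub, Real.exp_log hx]; field_simp
    have := mul_le_mul_of_nonneg_left h1 hx.le
    rw [h2]; linarith

/-- The truncation of `log x` to `[-n, n]`, with `log 0 = -∞`. -/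
noncomputable def truncLog (n x : ℝ) : ℝ :=
  if x = 0 then -n else max (-n) (min n (Real.log x))

lemma measurable_truncLog (n : ℝ) : Measurable (truncLog n) :=
  Measurable.ite (measurableSet_singleton 0) measurable_const
    (measurable_const.max (measurable_const.min Real.measurable_log))

lemma abs_truncLog_le {n : ℝ} (hn : 0 ≤ n) (x : ℝ) : |truncLog n x| ≤ n := by
  unfold truncLog
  split_ifs
  · simp [abs_of_nonneg hn]
  · exact abs_le.2 ⟨le_max_left _ _, max_le (by linarith) (min_le_left _ _)⟩

/-- For `x > 0` the truncation `t` lies between `0` and `log x`, so `t` and `x - exp t` never have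
opposite signs; hence `t x ≥ t exp t ≥ exp t - 1`. This nonnegativity lets the truncated functionals
be written as `lintegral`s, as Fatou requires. -/
lemma truncLog_nonneg {n x : ℝ} (hn : 0 ≤ n) (hx : 0 ≤ x) :
    0 ≤ truncLog n x * x - (Real.exp (truncLog n x) - 1) := by
  unfold truncLog
  split_ifs with h
  · simp [h, hn]
  · have hx : 0 < x := lt_of_le_of_ne hx (Ne.symm h)
    set t := max (-n) (min n (Real.log x)) with ht
    have h1 := Real.add_one_le_exp (-t)
    have h2 : Real.exp t * Real.exp (-t) = 1 := by rw [← Real.exp_add]; simp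
    have h3 : Real.exp t * (t - 0) ≥ Real.exp t - 1 := by
      nlinarith [Real.exp_pos t]
    rcases le_total 0 (Real.log x) with hl | hl
    · have ht0 : 0 ≤ t := le_max_of_le_right (le_min hn hl)
      have htl : t ≤ Real.log x := max_le (by linarith) (min_le_right _ _)
      have : Real.exp t ≤ x := by
        rw [← Real.exp_log hx]; exact Real.exp_le_exp.2 htl
      nlinarith
    · have ht0 : t ≤ 0 := max_le (by linarith) ((min_le_right _ _).trans hl)
      have htl : Real.log x ≤ t :=
        le_max_of_le_right (le_min (hl.trans hn) le_rfl)
      have : x ≤ Real.exp t := by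
        conv_lhs => rw [← Real.exp_log hx]
        exact Real.exp_le_exp.2 htl
      nlinarith

lemma tendsto_truncLog {x : ℝ} (hx : 0 ≤ x) :
    Tendsto (fun n : ℕ ↦ truncLog n x * x - (Real.exp (truncLog n x) - 1)) atTop
      (𝓝 (klFun x)) := by
  rcases hx.eq_or_lt with rfl | hx
  · simp only [truncLog, ↓reduceIte, mul_zero, klFun_zero]
    have h : Tendsto (fun n : ℕ ↦ Real.exp (-(n : ℝ))) atTop (𝓝 0) :=
      Real.tendsto_exp_neg_atTop_nhds_zero.comp tendsto_natCast_atTop_atTop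
    simpa using (h.sub_const 1).const_sub 0
  · refine tendsto_const_nhds.congr' ?_
    filter_upwards [eventually_ge_atTop ⌈|Real.log x|⌉₊] with n hn
    have hn' : |Real.log x| ≤ n := (Nat.le_ceil _).trans (by exact_mod_cast hn)
    have : truncLog n x = Real.log x := by
      unfold truncLog
      rw [if_neg hx.ne', min_eq_right (abs_le.1 hn').2, max_eq_right (abs_le.1 hn').1]
    rw [this, Real.exp_log hx, klFun_apply]
    ring

section

variable {α : Type*} [MeasurableSpace α] {μ ν : Measure α} [IsFiniteMeasure μ] [IsFiniteMeasure ν]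

/-- The easy half of the Donsker–Varadhan formula. -/
lemma ofReal_integral_sub_le_klDiv {φ : α → ℝ} (hμ : Integrable φ μ)
    (hν : Integrable (fun x ↦ Real.exp (φ x)) ν) :
    ENNReal.ofReal (∫ x, φ x ∂μ - ∫ x, (Real.exp (φ x) - 1) ∂ν) ≤ klDiv μ ν := by
  rw [klDiv_eq_integral_klFun]
  split_ifs with h
  swap; · exact le_top
  apply ENNReal.ofReal_le_ofReal
  have hi : Integrable (fun x ↦ (μ.rnDeriv ν x).toReal • φ x) ν :=
    (integrable_rnDeriv_smul_iff h.1).2 hμ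
  have he : Integrable (fun x ↦ Real.exp (φ x) - 1) ν := hν.sub (integrable_const 1)
  rw [← integral_rnDeriv_smul h.1, ← integral_sub hi he]
  refine integral_mono (hi.sub he)
    ((integrable_klFun_rnDeriv_iff h.1).2 h.2) fun x ↦ ?_
  have := mul_sub_exp_le_klFun (x := (μ.rnDeriv ν x).toReal) ENNReal.toReal_nonneg (φ x)
  simp only [smul_eq_mul]
  linarith

lemma integrable_of_abs_le_const {φ : α → ℝ} (hφ : Measurable φ) {n : ℝ} (hn : ∀ x, |φ x| ≤ n) :
    Integrable φ μ :=
  Integrable.of_bound hφ.aestronglyMeasurable n (ae_of_all _ hn)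

lemma integrable_exp_of_abs_le_const {φ : α → ℝ} (hφ : Measurable φ) {n : ℝ}
    (hn : ∀ x, |φ x| ≤ n) : Integrable (fun x ↦ Real.exp (φ x)) μ :=
  Integrable.of_bound hφ.exp.aestronglyMeasurable (Real.exp n) (ae_of_all _ fun x ↦ by
    rw [Real.norm_of_nonneg (Real.exp_pos _).le]
    exact Real.exp_le_exp.2 (abs_le.1 (hn x)).2)

/-- The divergence is approximated by the Donsker–Varadhan functional on bounded measurable
functions. -/
lemma exists_measurable_lt_of_lt_klDiv {c : ℝ≥0∞} (hc : c < klDiv μ ν) :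
    ∃ (n : ℝ) (φ : α → ℝ), Measurable φ ∧ (∀ x, |φ x| ≤ n) ∧
      c < ENNReal.ofReal (∫ x, φ x ∂μ - ∫ x, (Real.exp (φ x) - 1) ∂ν) := by
  by_cases h : μ ≪ ν
  · rw [klDiv_eq_lintegral_klFun_of_ac h] at hc
    set r : α → ℝ := fun x ↦ (μ.rnDeriv ν x).toReal with hr
    have hrm : Measurable r := (Measure.measurable_rnDeriv μ ν).ennreal_toReal
    have hr0 : ∀ x, 0 ≤ r x := fun x ↦ ENNReal.toReal_nonneg
    have key : ∫⁻ x, ENNReal.ofReal (klFun (r x)) ∂ν ≤ liminf (fun n : ℕ ↦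
        ∫⁻ x, ENNReal.ofReal (truncLog n (r x) * r x - (Real.exp (truncLog n (r x)) - 1)) ∂ν)
        atTop := by
      refine le_trans (le_of_eq ?_) (lintegral_liminf_le fun n ↦ ?_)
      · refine lintegral_congr fun x ↦ ?_
        exact (((ENNReal.continuous_ofReal.tendsto _).comp
          (tendsto_truncLog (hr0 x))).liminf_eq).symm
      · have := (measurable_truncLog n).comp hrm
        exact ((this.mul hrm).sub (this.exp.sub_const 1)).ennreal_ofReal
    obtain ⟨n, hn⟩ := (eventually_lt_of_lt_liminf (hc.trans_le key)).exists
    have hm : Measurable fun x ↦ truncLog n (r x) := (measurable_truncLog n).comp hrm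
    have hb : ∀ x, |truncLog n (r x)| ≤ n := fun x ↦ abs_truncLog_le n.cast_nonneg _
    refine ⟨n, fun x ↦ truncLog n (r x), hm, hb, hn.trans_eq ?_⟩
    have hi : Integrable (fun x ↦ r x • truncLog n (r x)) ν :=
      (integrable_rnDeriv_smul_iff h).2 (integrable_of_abs_le_const hm hb)
    have he : Integrable (fun x ↦ Real.exp (truncLog n (r x)) - 1) ν :=
      (integrable_exp_of_abs_le_const hm hb).sub (integrable_const 1)
    have hie : Integrable (fun x ↦ r x • truncLog n (r x) -
        (Real.exp (truncLog n (r x)) - 1)) ν := hi.sub he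
    rw [← integral_rnDeriv_smul h, ← integral_sub hi he,
      ofReal_integral_eq_lintegral_ofReal hie]
    · simp only [smul_eq_mul, mul_comm, r]
    · refine ae_of_all _ fun x ↦ ?_
      have := truncLog_nonneg n.cast_nonneg (hr0 x)
      simpa [mul_comm] using this
  -- Without absolute continuity, a large multiple of the indicator of a `ν`-null set charged by `μ`
  -- makes the functional arbitrarily large, since its exponential term vanishes.
  · obtain ⟨E, hE, hν, hμ⟩ : ∃ E, MeasurableSet E ∧ ν E = 0 ∧ μ E ≠ 0 := by
      by_contra! H
      exact h (Measure.AbsolutelyContinuous.mk fun E hE h0 ↦ H E hE h0)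
    have hc' : c ≠ ∞ := (hc.trans_le le_top).ne
    have hpos : 0 < μ.real E := ENNReal.toReal_pos hμ (measure_ne_top _ _)
    obtain ⟨n, hn⟩ := exists_nat_gt (c.toReal / μ.real E)
    refine ⟨n, E.indicator fun _ ↦ (n : ℝ), measurable_const.indicator hE, fun x ↦ ?_, ?_⟩
    · by_cases hx : x ∈ E <;> simp [hx]
    · have h0 : ∫ x, (Real.exp (E.indicator (fun _ ↦ (n : ℝ)) x) - 1) ∂ν = 0 := by
        rw [← integral_zero α ℝ (μ := ν)]
        refine integral_congr_ae ?_
        have : ∀ᵐ x ∂ν, x ∉ E := measure_eq_zero_iff_ae_notMem.1 hν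
        filter_upwards [this] with x hx
        simp [hx]
      rw [h0, integral_indicator_const _ hE, sub_zero, smul_eq_mul,
        ← ENNReal.ofReal_toReal hc']
      rw [div_lt_iff₀ hpos] at hn
      have := ENNReal.toReal_nonneg (a := c)
      exact (ENNReal.ofReal_lt_ofReal_iff (by linarith)).2 (by linarith)

end

variable {Ω : Type*} [MeasurableSpace Ω] [TopologicalSpace Ω] [T4Space Ω] [BorelSpace Ω]

open BoundedContinuousFunction in
-- Bounded continuous functions are dense in `L¹(μ + ν)`, which controls both integrals at once.
-- Clipping the approximant to `[-n, n]` does not increase its distance to `φ` and makes `exp`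
-- Lipschitz on the relevant range.
lemma exists_boundedContinuous_lt_of_lt_klDiv {μ ν : Measure Ω} [IsFiniteMeasure μ]
    [IsFiniteMeasure ν] [(μ + ν).WeaklyRegular] {c : ℝ≥0∞} (hc : c < klDiv μ ν) :
    ∃ φ : Ω →ᵇ ℝ, c < ENNReal.ofReal (∫ x, φ x ∂μ - ∫ x, (Real.exp (φ x) - 1) ∂ν) := by
  obtain ⟨n, φ, hφ, hb, hlt⟩ := exists_measurable_lt_of_lt_klDiv hc
  set a := ∫ x, φ x ∂μ - ∫ x, (Real.exp (φ x) - 1) ∂ν with ha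
  have hc' : c ≠ ∞ := (hc.trans_le le_top).ne
  have hca : c.toReal < a := by
    by_contra! h
    exact (ENNReal.ofReal_le_ofReal h).not_gt (by rwa [ENNReal.ofReal_toReal hc'])
  -- The linear term loses at most `ε` and the exponential term at most `exp n * ε`, so together
  -- they use up at most half of the gap `a - c`.
  set ε := (a - c.toReal) / (2 * (1 + Real.exp n)) with hε
  have hε0 : 0 < ε := div_pos (by linarith) (by positivity)
  obtain ⟨g, hg, hgi⟩ := (integrable_of_abs_le_const (μ := μ + ν) hφ
    hb).exists_boundedContinuous_integral_sub_le hε0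
  have hψc : Continuous fun x ↦ max (-n) (min n (g x)) := by fun_prop
  set ψ : Ω → ℝ := fun x ↦ max (-n) (min n (g x)) with hψ
  have hψb : ∀ x, |ψ x| ≤ n := fun x ↦ by
    have h0 : 0 ≤ n := (abs_nonneg _).trans (hb x)
    exact abs_le.2 ⟨le_max_left _ _, max_le (by linarith) (min_le_left _ _)⟩
  have hle : ∀ x, |φ x - ψ x| ≤ ‖φ x - g x‖ := fun x ↦ by
    have h1 := abs_le.1 (hb x)
    have : φ x = max (-n) (min n (φ x)) := by rw [min_eq_right h1.2, max_eq_right h1.1]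
    calc |φ x - ψ x| = |max (-n) (min n (φ x)) - max (-n) (min n (g x))| := by rw [← this]
      _ ≤ |min n (φ x) - min n (g x)| := by
        simpa using abs_max_sub_max_le_max (-n) (min n (φ x)) (-n) (min n (g x))
      _ ≤ |φ x - g x| := by
        simpa using abs_min_sub_min_le_max n (φ x) n (g x)
      _ = _ := (Real.norm_eq_abs _).symm
  have hd : Integrable (fun x ↦ φ x - ψ x) (μ + ν) :=
    (integrable_of_abs_le_const hφ hb).sub (integrable_of_abs_le_const hψc.measurable hψb)
  obtain ⟨hdμi, hdνi⟩ := integrable_add_measure.1 hd.abs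
  have hsum : ∫ x, |φ x - ψ x| ∂μ + ∫ x, |φ x - ψ x| ∂ν ≤ ε := by
    rw [← integral_add_measure hdμi hdνi]
    refine le_trans (integral_mono hd.abs ?_ hle) hg
    exact ((integrable_of_abs_le_const hφ hb).sub hgi).norm
  have hdμ : 0 ≤ ∫ x, |φ x - ψ x| ∂μ := integral_nonneg fun _ ↦ abs_nonneg _
  have hdν : 0 ≤ ∫ x, |φ x - ψ x| ∂ν := integral_nonneg fun _ ↦ abs_nonneg _
  have h1 : ∫ x, φ x ∂μ - ∫ x, ψ x ∂μ ≤ ∫ x, |φ x - ψ x| ∂μ := by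
    rw [← integral_sub (integrable_of_abs_le_const hφ hb)
      (integrable_of_abs_le_const hψc.measurable hψb)]
    exact (le_abs_self _).trans abs_integral_le_integral_abs
  have heφ := (integrable_exp_of_abs_le_const (μ := ν) hφ hb).sub (integrable_const 1)
  have heψ := (integrable_exp_of_abs_le_const (μ := ν) hψc.measurable hψb).sub (integrable_const 1)
  have h2 : ∫ x, (Real.exp (ψ x) - 1) ∂ν - ∫ x, (Real.exp (φ x) - 1) ∂ν ≤
      Real.exp n * ∫ x, |φ x - ψ x| ∂ν := by
    rw [← integral_const_mul]
    refine le_trans (integral_sub heψ heφ).ge ?_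
    refine integral_mono (heψ.sub heφ) (hdνi.const_mul _) fun x ↦ ?_
    have h3 := Real.add_one_le_exp (φ x - ψ x)
    have h4 : Real.exp (φ x) = Real.exp (ψ x) * Real.exp (φ x - ψ x) := by
      rw [← Real.exp_add]; ring_nf
    have h5 : Real.exp (ψ x) ≤ Real.exp n := Real.exp_le_exp.2 (abs_le.1 (hψb x)).2
    have h6 := mul_le_mul_of_nonneg_left h3 (Real.exp_pos (ψ x)).le
    have h8 : Real.exp (ψ x) * (-(φ x - ψ x)) ≤ Real.exp n * |φ x - ψ x| :=
      (mul_le_mul_of_nonneg_left (neg_le_abs _) (Real.exp_pos _).le).trans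
        (mul_le_mul_of_nonneg_right h5 (abs_nonneg _))
    simp only [Pi.sub_apply]
    linarith
  refine ⟨ofNormedAddCommGroup ψ hψc n hψb, ?_⟩
  simp only [coe_ofNormedAddCommGroup]
  rw [← ENNReal.ofReal_toReal hc']
  have h9 : ε * (1 + Real.exp n) = (a - c.toReal) / 2 := by
    rw [hε]; field_simp
  have h10 : c.toReal < ∫ x, ψ x ∂μ - ∫ x, (Real.exp (ψ x) - 1) ∂ν := by
    have := Real.exp_pos n
    nlinarith
  exact (ENNReal.ofReal_lt_ofReal_iff (ENNReal.toReal_nonneg.trans_lt h10)).2 h10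

/-- The Kullback–Leibler divergence is weakly lower semicontinuous in its first argument. -/
theorem klDiv_le_liminf_klDiv [HasOuterApproxClosed Ω]
    {ι : Type*} {l : Filter ι} {μs : ι → ProbabilityMeasure Ω} {μ : ProbabilityMeasure Ω}
    (h : Tendsto μs l (𝓝 μ)) (ν : Measure Ω) [IsFiniteMeasure ν]
    [((μ : Measure Ω) + ν).WeaklyRegular] :
    klDiv (μ : Measure Ω) ν ≤ liminf (fun i ↦ klDiv (μs i : Measure Ω) ν) l := by
  refine le_of_forall_lt fun c hc ↦ ?_
  obtain ⟨c', hcc', hc'⟩ := exists_between hc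
  refine hcc'.trans_le ?_
  obtain ⟨φ, hφ⟩ := exists_boundedContinuous_lt_of_lt_klDiv hc'
  have hlim := ProbabilityMeasure.tendsto_iff_forall_integral_tendsto.1 h φ
  have hlim' := (ENNReal.continuous_ofReal.tendsto _).comp
    (hlim.sub_const (∫ x, (Real.exp (φ x) - 1) ∂ν))
  refine le_liminf_of_le (by isBoundedDefault) ?_
  filter_upwards [hlim'.eventually_const_lt hφ] with i hi
  refine hi.le.trans (ofReal_integral_sub_le_klDiv (φ.integrable _) ?_)
  exact integrable_exp_of_abs_le_const φ.continuous.measurable (n := ‖φ‖) fun x ↦ φ.norm_coe_le_norm x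

end KLSemicontinuity

/-! ### Change of reference measure -/

section Tilting

variable {α : Type*} [MeasurableSpace α]

/-- Change of reference measure in the divergence, by an exponential tilt. -/
lemma klDiv_add_log_eq_klDiv_tilted_add {μ ν : Measure α} [IsProbabilityMeasure μ]
    [IsProbabilityMeasure ν] {f : α → ℝ} (hf0 : ∀ x, 0 ≤ f x) (hfμ : Integrable f μ)
    (hfν : Integrable (fun x ↦ Real.exp (f x)) ν) :
    klDiv μ ν + ENNReal.ofReal (Real.log (∫ x, Real.exp (f x) ∂ν)) =
      klDiv μ (ν.tilted f) + ∫⁻ x, ENNReal.ofReal (f x) ∂μ := by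
  have := isProbabilityMeasure_tilted hfν
  rw [← ofReal_integral_eq_lintegral_ofReal hfμ (ae_of_all _ hf0)]
  by_cases hac : μ ≪ ν
  swap
  · have hac' : ¬ μ ≪ ν.tilted f := fun h ↦ hac (h.trans (tilted_absolutelyContinuous ν f))
    simp [klDiv_of_not_ac hac, klDiv_of_not_ac hac']
  have hac' : μ ≪ ν.tilted f := hac.trans (absolutelyContinuous_tilted hfν)
  by_cases hi : Integrable (llr μ ν) μ
  · have hi' := integrable_llr_tilted_right hac hfμ hi hfν
    have h1 := integral_llr_tilted_right hac hfμ hfν hi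
    have h2 := integral_llr_add_sub_measure_univ_nonneg hac hi
    have h3 := integral_llr_add_sub_measure_univ_nonneg hac' hi'
    -- Nonnegativity of `f` ensures that `ENNReal.ofReal` does not truncate the logarithm.
    have hlog : 0 ≤ Real.log (∫ x, Real.exp (f x) ∂ν) := by
      refine Real.log_nonneg ?_
      calc (1 : ℝ) = ∫ _, 1 ∂ν := by simp
        _ ≤ _ := integral_mono (integrable_const _) hfν fun x ↦ Real.one_le_exp (hf0 x)
    rw [klDiv_of_ac_of_integrable hac hi, klDiv_of_ac_of_integrable hac' hi',
      ← ENNReal.ofReal_add h2 hlog, ← ENNReal.ofReal_add h3 (integral_nonneg hf0), h1]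
    simp only [probReal_univ]
    congr 1
    ring
  -- The two log-likelihood ratios differ by a `μ`-integrable function, so both divergences are
  -- infinite together.
  · have hi' : ¬ Integrable (llr μ (ν.tilted f)) μ := by
      rw [integrable_congr (llr_tilted_right hac hfν)]
      intro h
      refine hi ?_
      have := (h.add hfμ).sub (integrable_const (Real.log (∫ z, Real.exp (f z) ∂ν)))
      refine this.congr (ae_of_all _ fun x ↦ ?_)
      simp only [Pi.add_apply, Pi.sub_apply]
      ring
    simp [klDiv_of_not_integrable hi, klDiv_of_not_integrable hi']

end Tilting

/-! ### The Gaussian kernel relative to the standard Gaussian -/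

section GaussianKernel

variable {E : Type*} [NormedAddCommGroup E] [InnerProductSpace ℝ E]

/-- The density of `N(z, r² I)` with respect to the standard Gaussian measure. -/
noncomputable def gaussianKernel (r : ℝ) (z y : E) : ℝ :=
  (r ^ Module.finrank ℝ E)⁻¹ * Real.exp (1 / 2 * ‖y‖ ^ 2 - 1 / 2 * ‖r⁻¹ • (y - z)‖ ^ 2)

lemma gaussianKernel_pos {r : ℝ} (hr : 0 < r) (z y : E) : 0 < gaussianKernel r z y := by
  unfold gaussianKernel; positivity

lemma continuous_gaussianKernel (r : ℝ) :
    Continuous fun p : E × E ↦ gaussianKernel r p.1 p.2 := by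
  unfold gaussianKernel; fun_prop

lemma continuous_gaussianKernel_left (r : ℝ) (y : E) :
    Continuous fun z : E ↦ gaussianKernel r z y := by
  unfold gaussianKernel; fun_prop

/-- The bound does not depend on `z`: for fixed `y` the kernel is thus an admissible test function
for weak convergence of the law of `z`. -/
lemma gaussianKernel_le {r : ℝ} (hr : 0 < r) (z y : E) :
    gaussianKernel r z y ≤ (r ^ Module.finrank ℝ E)⁻¹ * Real.exp (1 / 2 * ‖y‖ ^ 2) := by
  unfold gaussianKernel
  gcongr
  have : 0 ≤ ‖r⁻¹ • (y - z)‖ ^ 2 := by positivity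
  linarith

end GaussianKernel

/-! ### Lebesgue density of the standard Gaussian -/

section GaussianDensity

variable (E : Type*) [NormedAddCommGroup E] [InnerProductSpace ℝ E] [FiniteDimensional ℝ E]
  [MeasurableSpace E] [BorelSpace E]

/-- The Gaussian integral `∫ exp (-‖x‖² / 2) dx`. -/
noncomputable def gaussianNorm : ℝ := ∫ x : E, Real.exp (-(1 / 2) * ‖x‖ ^ 2)

lemma gaussianNorm_pos : 0 < gaussianNorm E := by
  rw [gaussianNorm, GaussianFourier.integral_rexp_neg_mul_sq_norm (by norm_num)]
  positivity

lemma integrable_exp_neg_mul_sq_norm {b : ℝ} (hb : 0 < b) :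
    Integrable fun x : E ↦ Real.exp (-b * ‖x‖ ^ 2) := by
  have h := (GaussianFourier.integrable_cexp_neg_mul_sq_norm_add (V := E) (b := (b : ℂ))
    (by simpa using hb) 0 0).re
  refine h.congr (ae_of_all _ fun x ↦ ?_)
  simp only [zero_mul, add_zero, RCLike.re_to_complex]
  rw [show (-(b : ℂ) * (‖x‖ : ℂ) ^ 2) = ((-b * ‖x‖ ^ 2 : ℝ) : ℂ) by push_cast; ring,
    Complex.exp_ofReal_re]

/-- The density of the standard Gaussian measure. -/
noncomputable def stdGaussianDensity (x : E) : ℝ :=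
  (gaussianNorm E)⁻¹ * Real.exp (-(1 / 2) * ‖x‖ ^ 2)

variable {E}

lemma stdGaussianDensity_pos (x : E) : 0 < stdGaussianDensity E x :=
  mul_pos (inv_pos.2 (gaussianNorm_pos E)) (Real.exp_pos _)

variable (E) in
lemma continuous_stdGaussianDensity : Continuous (stdGaussianDensity E) := by
  unfold stdGaussianDensity; fun_prop

-- Both sides have the same characteristic function, by the Gaussian integral with an imaginary
-- linear term.
variable (E) in
lemma stdGaussian_eq_withDensity :
    stdGaussian E = volume.withDensity fun x ↦ ENNReal.ofReal (stdGaussianDensity E x) := by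
  have hm : Measurable fun x ↦ ENNReal.ofReal (stdGaussianDensity E x) :=
    (continuous_stdGaussianDensity E).measurable.ennreal_ofReal
  have hint : Integrable (stdGaussianDensity E) :=
    (integrable_exp_neg_mul_sq_norm E (b := 1 / 2) (by norm_num)).const_mul _
  have : IsFiniteMeasure
      (volume.withDensity fun x : E ↦ ENNReal.ofReal (stdGaussianDensity E x)) :=
    isFiniteMeasure_withDensity_ofReal hint.2
  refine Measure.ext_of_charFun ?_
  ext t
  rw [charFun_stdGaussian, charFun_apply,
    integral_withDensity_eq_integral_toReal_smul hm (ae_of_all _ fun _ ↦ ENNReal.ofReal_lt_top)]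
  have hZ : (gaussianNorm E : ℂ) = ∫ x : E, Complex.exp (-(1 / 2 : ℂ) * ‖x‖ ^ 2) := by
    rw [gaussianNorm, ← integral_complex_ofReal]
    push_cast
    rfl
  have hZ0 : (gaussianNorm E : ℂ) ≠ 0 := by exact_mod_cast (gaussianNorm_pos E).ne'
  have hI := GaussianFourier.integral_cexp_neg_mul_sq_norm_add (V := E) (b := (1 / 2 : ℂ))
    (by norm_num) Complex.I t
  rw [← GaussianFourier.integral_cexp_neg_mul_sq_norm (by norm_num), ← hZ] at hI
  have h1 : ∀ x : E, (ENNReal.ofReal (stdGaussianDensity E x)).toReal •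
      Complex.exp (inner ℝ x t * Complex.I) = (gaussianNorm E : ℂ)⁻¹ *
        Complex.exp (-(1 / 2 : ℂ) * ‖x‖ ^ 2 + Complex.I * inner ℝ t x) := by
    intro x
    rw [ENNReal.toReal_ofReal (stdGaussianDensity_pos x).le, stdGaussianDensity, Complex.exp_add,
      real_inner_comm, Complex.real_smul]
    push_cast
    ring_nf
  simp_rw [h1]
  rw [integral_const_mul, hI, inv_mul_cancel_left₀ hZ0]
  congr 1
  rw [Complex.I_sq]
  ring

lemma lintegral_stdGaussian {F : E → ℝ≥0∞} (hF : Measurable F) :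
    ∫⁻ x, F x ∂(stdGaussian E) = ∫⁻ x, ENNReal.ofReal (stdGaussianDensity E x) * F x := by
  rw [stdGaussian_eq_withDensity, lintegral_withDensity_eq_lintegral_mul _
    (continuous_stdGaussianDensity E).measurable.ennreal_ofReal hF]
  rfl

variable (E) in
lemma integrable_exp_mul_sq_norm_stdGaussian {c : ℝ} (hc : c < 1 / 2) :
    Integrable (fun x : E ↦ Real.exp (c * ‖x‖ ^ 2)) (stdGaussian E) := by
  rw [stdGaussian_eq_withDensity,
    integrable_withDensity_iff (continuous_stdGaussianDensity E).measurable.ennreal_ofReal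
      (ae_of_all _ fun _ ↦ ENNReal.ofReal_lt_top)]
  refine ((integrable_exp_neg_mul_sq_norm E (b := 1 / 2 - c) (by linarith)).const_mul
    (gaussianNorm E)⁻¹).congr (ae_of_all _ fun x ↦ ?_)
  simp only
  rw [ENNReal.toReal_ofReal (stdGaussianDensity_pos x).le, stdGaussianDensity, mul_left_comm,
    ← Real.exp_add]
  ring_nf

lemma lintegral_comp_smul_add {r : ℝ} (hr : 0 < r) (z : E) {G : E → ℝ≥0∞} (hG : Measurable G) :
    ∫⁻ w, G (z + r • w) = ENNReal.ofReal (r ^ Module.finrank ℝ E)⁻¹ * ∫⁻ y, G y := by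
  have h := Measure.map_addHaar_smul (volume : Measure E) hr.ne'
  have h2 : ∫⁻ w, G (z + r • w) = ∫⁻ y, G (z + y) ∂(Measure.map (r • ·) (volume : Measure E)) := by
    rw [lintegral_map (by fun_prop) (by fun_prop)]
  rw [h2, h, lintegral_smul_measure, lintegral_add_left_eq_self, abs_of_pos (by positivity)]
  rfl

/-- Substitute `y = z + r w` in Lebesgue measure, then divide the resulting density by that of the
standard Gaussian. -/
lemma lintegral_stdGaussian_add_smul {r : ℝ} (hr : 0 < r) (z : E) {F : E → ℝ≥0∞}
    (hF : Measurable F) :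
    ∫⁻ w, F (z + r • w) ∂(stdGaussian E) =
      ∫⁻ y, ENNReal.ofReal (gaussianKernel r z y) * F y ∂(stdGaussian E) := by
  have hk : Measurable fun y ↦ gaussianKernel r z y :=
    ((continuous_gaussianKernel r).comp (by fun_prop : Continuous fun y : E ↦ (z, y))).measurable
  have hd := (continuous_stdGaussianDensity E).measurable
  rw [lintegral_stdGaussian (by fun_prop), lintegral_stdGaussian (by fun_prop)]
  have h := lintegral_comp_smul_add hr z
    (G := fun y ↦ ENNReal.ofReal (stdGaussianDensity E (r⁻¹ • (y - z))) * F y) (by fun_prop)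
  simp only [add_sub_cancel_left, inv_smul_smul₀ hr.ne'] at h
  rw [h, ← lintegral_const_mul _ (by fun_prop)]
  refine lintegral_congr fun y ↦ ?_
  rw [← mul_assoc, ← mul_assoc, ← ENNReal.ofReal_mul (by positivity),
    ← ENNReal.ofReal_mul (stdGaussianDensity_pos y).le]
  congr 2
  unfold stdGaussianDensity gaussianKernel
  rw [show -(1 / 2) * ‖r⁻¹ • (y - z)‖ ^ 2 = -(1 / 2) * ‖y‖ ^ 2 +
    (1 / 2 * ‖y‖ ^ 2 - 1 / 2 * ‖r⁻¹ • (y - z)‖ ^ 2) by ring, Real.exp_add]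
  ring

end GaussianDensity

/-! ### Entropy deficit of a smoothed law -/

section Smoothing

variable {E : Type*} [NormedAddCommGroup E] [InnerProductSpace ℝ E] [FiniteDimensional ℝ E]
  [MeasurableSpace E] [BorelSpace E]

/-- The density of `ρ ∗ N(0, r² I)` with respect to the standard Gaussian measure. -/
noncomputable def mixtureDensity (r : ℝ) (ρ : Measure E) (y : E) : ℝ :=
  ∫ z, gaussianKernel r z y ∂ρ

lemma integrable_gaussianKernel {r : ℝ} (hr : 0 < r) (ρ : Measure E) [IsFiniteMeasure ρ] (y : E) :
    Integrable (fun z ↦ gaussianKernel r z y) ρ := by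
  have hc := continuous_gaussianKernel_left r y
  refine Integrable.of_bound hc.aestronglyMeasurable
    ((r ^ Module.finrank ℝ E)⁻¹ * Real.exp (1 / 2 * ‖y‖ ^ 2)) (ae_of_all _ fun z ↦ ?_)
  rw [Real.norm_of_nonneg (gaussianKernel_pos hr z y).le]
  exact gaussianKernel_le hr z y

lemma mixtureDensity_pos {r : ℝ} (hr : 0 < r) (ρ : Measure E) [IsProbabilityMeasure ρ] (y : E) :
    0 < mixtureDensity r ρ y := by
  rw [mixtureDensity, integral_pos_iff_support_of_nonneg
    (fun z ↦ (gaussianKernel_pos hr z y).le) (integrable_gaussianKernel hr ρ y)]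
  have : Function.support (fun z ↦ gaussianKernel r z y) = Set.univ :=
    Set.eq_univ_of_forall fun z ↦ (gaussianKernel_pos hr z y).ne'
  simp [this]

variable (E) in
/-- An upper bound for the logarithm of the normalizing constant of `gaussianKernel`. -/
noncomputable def logBound (r : ℝ) : ℝ := |Real.log (r ^ Module.finrank ℝ E)⁻¹|

variable (E) in
lemma logBound_nonneg (r : ℝ) : 0 ≤ logBound E r := abs_nonneg _

lemma log_mixtureDensity_le {r : ℝ} (hr : 0 < r) (ρ : Measure E) [IsProbabilityMeasure ρ] (y : E) :
    Real.log (mixtureDensity r ρ y) ≤ logBound E r + 1 / 2 * ‖y‖ ^ 2 := by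
  have h : mixtureDensity r ρ y ≤
      (r ^ Module.finrank ℝ E)⁻¹ * Real.exp (1 / 2 * ‖y‖ ^ 2) := by
    calc mixtureDensity r ρ y
        ≤ ∫ _, (r ^ Module.finrank ℝ E)⁻¹ * Real.exp (1 / 2 * ‖y‖ ^ 2) ∂ρ :=
          integral_mono (integrable_gaussianKernel hr ρ y) (integrable_const _)
            fun z ↦ gaussianKernel_le hr z y
      _ = _ := by simp
  refine (Real.log_le_log (mixtureDensity_pos hr ρ y) h).trans ?_
  rw [Real.log_mul (by positivity) (Real.exp_pos _).ne', Real.log_exp]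
  gcongr
  exact le_abs_self _

/-- The nonnegative integrand of the entropy deficit of `ρ ∗ N(0, r² I)`. -/
noncomputable def deficit (r : ℝ) (ρ : Measure E) (y : E) : ℝ :=
  mixtureDensity r ρ y * (logBound E r + 1 / 2 * ‖y‖ ^ 2 - Real.log (mixtureDensity r ρ y))

lemma deficit_nonneg {r : ℝ} (hr : 0 < r) (ρ : Measure E) [IsProbabilityMeasure ρ] (y : E) :
    0 ≤ deficit r ρ y :=
  mul_nonneg (mixtureDensity_pos hr ρ y).le (sub_nonneg.2 (log_mixtureDensity_le hr ρ y))

lemma measurable_mixtureDensity_uncurry {V : Type*} [MeasurableSpace V] (r : ℝ) {ρ : V → Measure E}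
    (hρ : Measurable ρ) [∀ v, IsProbabilityMeasure (ρ v)] :
    Measurable fun p : V × E ↦ mixtureDensity r (ρ p.1) p.2 := by
  let κ : Kernel V E := ⟨ρ, hρ⟩
  have : IsMarkovKernel κ := ⟨fun v ↦ inferInstanceAs (IsProbabilityMeasure (ρ v))⟩
  have hk : StronglyMeasurable
      (Function.uncurry fun (p : V × E) (z : E) ↦ gaussianKernel r z p.2) :=
    ((continuous_gaussianKernel r).measurable.comp
      (by fun_prop : Measurable fun q : (V × E) × E ↦ (q.2, q.1.2))).stronglyMeasurable
  exact (hk.integral_kernel_prod_right (κ := Kernel.prodMkRight E κ)).measurable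

lemma measurable_mixtureDensity (r : ℝ) (ρ : Measure E) [IsProbabilityMeasure ρ] :
    Measurable (mixtureDensity r ρ) :=
  (continuous_gaussianKernel r).measurable.stronglyMeasurable.integral_prod_left'.measurable

lemma measurable_deficit_uncurry {V : Type*} [MeasurableSpace V] (r : ℝ) {ρ : V → Measure E}
    (hρ : Measurable ρ) [∀ v, IsProbabilityMeasure (ρ v)] :
    Measurable fun p : V × E ↦ deficit r (ρ p.1) p.2 := by
  have h := measurable_mixtureDensity_uncurry r hρ
  unfold deficit
  exact h.mul ((by fun_prop : Measurable fun p : V × E ↦ logBound E r + 1 / 2 * ‖p.2‖ ^ 2).sub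
    h.log)

lemma measurable_deficit (r : ℝ) (ρ : Measure E) [IsProbabilityMeasure ρ] :
    Measurable (deficit r ρ) := by
  have h := measurable_mixtureDensity r ρ
  unfold deficit
  fun_prop

lemma conv_map_smul_stdGaussian {r : ℝ} (hr : 0 < r) (ρ : Measure E) [IsProbabilityMeasure ρ] :
    ρ ∗ (stdGaussian E).map (fun w ↦ r • w) =
      (stdGaussian E).withDensity fun y ↦ ENNReal.ofReal (mixtureDensity r ρ y) := by
  refine Measure.ext_of_lintegral _ fun F hF ↦ ?_
  have hk : Measurable fun p : E × E ↦ ENNReal.ofReal (gaussianKernel r p.1 p.2) :=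
    (continuous_gaussianKernel r).measurable.ennreal_ofReal
  rw [Measure.lintegral_conv hF, lintegral_withDensity_eq_lintegral_mul _
    (measurable_mixtureDensity r ρ).ennreal_ofReal hF]
  have h1 : ∀ z, ∫⁻ y, F (z + y) ∂((stdGaussian E).map fun w ↦ r • w) =
      ∫⁻ y, ENNReal.ofReal (gaussianKernel r z y) * F y ∂(stdGaussian E) := fun z ↦ by
    rw [lintegral_map (by fun_prop) (by fun_prop), lintegral_stdGaussian_add_smul hr z hF]
  simp_rw [h1]
  rw [lintegral_lintegral_swap]
  · refine lintegral_congr fun y ↦ ?_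
    have hky : Measurable fun z ↦ ENNReal.ofReal (gaussianKernel r z y) :=
      (continuous_gaussianKernel_left r y).measurable.ennreal_ofReal
    rw [lintegral_mul_const _ hky, Pi.mul_apply, mixtureDensity,
      ofReal_integral_eq_lintegral_ofReal (integrable_gaussianKernel hr ρ y)
        (ae_of_all _ fun z ↦ (gaussianKernel_pos hr z y).le)]
  · exact (hk.mul (hF.comp measurable_snd)).aemeasurable

/-- The divergence of a smoothed law from the standard Gaussian, plus its entropy deficit, is an
affine function of its second moment. -/
lemma klDiv_conv_add_lintegral_deficit {r : ℝ} (hr : 0 < r) (ρ : Measure E)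
    [IsProbabilityMeasure ρ] :
    klDiv (ρ ∗ (stdGaussian E).map (fun w ↦ r • w)) (stdGaussian E) +
        ∫⁻ y, ENNReal.ofReal (deficit r ρ y) ∂(stdGaussian E) =
      ENNReal.ofReal (logBound E r) +
        2⁻¹ * ∫⁻ y, ‖y‖ₑ ^ 2 ∂(ρ ∗ (stdGaussian E).map (fun w ↦ r • w)) := by
  have : IsProbabilityMeasure ((stdGaussian E).map (fun w ↦ r • w)) :=
    Measure.isProbabilityMeasure_map (by fun_prop)
  have hP : IsProbabilityMeasure (ρ ∗ (stdGaussian E).map (fun w ↦ r • w)) := inferInstance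
  have hpm := measurable_mixtureDensity r ρ
  rw [conv_map_smul_stdGaussian hr ρ] at hP ⊢
  set p := mixtureDensity r ρ with hp
  have hp0 : ∀ y, 0 < p y := mixtureDensity_pos hr ρ
  set P := (stdGaussian E).withDensity fun y ↦ ENNReal.ofReal (p y) with hPdef
  have hdm := measurable_deficit r ρ
  have hkl : Measurable fun y ↦ klFun (p y) := measurable_klFun.comp hpm
  have h1 : klDiv P (stdGaussian E) = ∫⁻ y, ENNReal.ofReal (klFun (p y)) ∂(stdGaussian E) := by
    rw [klDiv_eq_lintegral_klFun_of_ac (withDensity_absolutelyContinuous _ _)]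
    refine lintegral_congr_ae ?_
    filter_upwards [Measure.rnDeriv_withDensity (stdGaussian E) hpm.ennreal_ofReal] with y hy
    rw [hy, ENNReal.toReal_ofReal (hp0 y).le]
  have h2 : ∫⁻ y, ENNReal.ofReal (p y) ∂(stdGaussian E) = 1 := by
    have := hP.measure_univ
    rwa [hPdef, withDensity_apply _ MeasurableSet.univ, setLIntegral_univ] at this
  have h3 : ENNReal.ofReal (logBound E r) + 2⁻¹ * ∫⁻ y, ‖y‖ₑ ^ 2 ∂P =
      ∫⁻ y, ENNReal.ofReal (p y * (logBound E r + 1 / 2 * ‖y‖ ^ 2)) ∂(stdGaussian E) := by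
    have : ∀ y, ENNReal.ofReal (p y * (logBound E r + 1 / 2 * ‖y‖ ^ 2)) =
        ENNReal.ofReal (p y) * (ENNReal.ofReal (logBound E r) + 2⁻¹ * ‖y‖ₑ ^ 2) := fun y ↦ by
      rw [ENNReal.ofReal_mul (hp0 y).le, ENNReal.ofReal_add (logBound_nonneg E r) (by positivity),
        ENNReal.ofReal_mul (by norm_num), ENNReal.ofReal_pow (norm_nonneg _), ofReal_norm,
        one_div, ENNReal.ofReal_inv_of_pos (by norm_num), ENNReal.ofReal_ofNat]
    simp_rw [this]
    have h := lintegral_withDensity_eq_lintegral_mul (stdGaussian E) hpm.ennreal_ofReal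
      (g := fun y ↦ ENNReal.ofReal (logBound E r) + 2⁻¹ * ‖y‖ₑ ^ 2) (by fun_prop)
    simp only [Pi.mul_apply] at h
    rw [← h, ← hPdef, lintegral_add_left measurable_const, lintegral_const_mul _ (by fun_prop)]
    simp
  -- The added `1` is read as `∫ p` on the left and as `∫ 1` on the right. This cancels the `1 - p`
  -- in `klFun p` and leaves a pointwise identity between nonnegative functions, with no subtraction
  -- of possibly infinite integrals.
  have key : klDiv P (stdGaussian E) + ∫⁻ y, ENNReal.ofReal (deficit r ρ y) ∂(stdGaussian E) + 1 =
      ENNReal.ofReal (logBound E r) + 2⁻¹ * ∫⁻ y, ‖y‖ₑ ^ 2 ∂P + 1 := by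
    rw [h1, h3]
    nth_rw 1 [← h2]
    have h4 : (1 : ℝ≥0∞) = ∫⁻ _, 1 ∂(stdGaussian E) := by simp
    rw [h4, ← lintegral_add_left hkl.ennreal_ofReal, ← lintegral_add_right _ hpm.ennreal_ofReal,
      ← lintegral_add_right _ measurable_const]
    refine lintegral_congr fun y ↦ ?_
    have h5 : 0 ≤ logBound E r := logBound_nonneg E r
    have h6 := hp0 y
    rw [← ENNReal.ofReal_one, ← ENNReal.ofReal_add (klFun_nonneg h6.le) (deficit_nonneg hr ρ y),
      ← ENNReal.ofReal_add (add_nonneg (klFun_nonneg h6.le) (deficit_nonneg hr ρ y)) h6.le,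
      ← ENNReal.ofReal_add (by positivity) zero_le_one]
    congr 1
    rw [klFun_apply, deficit, ← hp]
    ring
  exact (ENNReal.add_left_inj ENNReal.one_ne_top).1 key

lemma tendsto_mixtureDensity {r : ℝ} (hr : 0 < r) {ι : Type*} {l : Filter ι}
    {ρ : ι → ProbabilityMeasure E} {ρ' : ProbabilityMeasure E} (h : Tendsto ρ l (𝓝 ρ')) (y : E) :
    Tendsto (fun i ↦ mixtureDensity r (ρ i : Measure E) y) l
      (𝓝 (mixtureDensity r (ρ' : Measure E) y)) := by
  have hc := continuous_gaussianKernel_left r y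
  exact ProbabilityMeasure.tendsto_iff_forall_integral_tendsto.1 h
    (BoundedContinuousFunction.ofNormedAddCommGroup _ hc _ fun z ↦ by
      rw [Real.norm_of_nonneg (gaussianKernel_pos hr z y).le]
      exact gaussianKernel_le hr z y)

lemma tendsto_deficit {r : ℝ} (hr : 0 < r) {ι : Type*} {l : Filter ι}
    {ρ : ι → ProbabilityMeasure E} {ρ' : ProbabilityMeasure E} (h : Tendsto ρ l (𝓝 ρ')) (y : E) :
    Tendsto (fun i ↦ deficit r (ρ i : Measure E) y) l (𝓝 (deficit r (ρ' : Measure E) y)) := by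
  have h1 := tendsto_mixtureDensity hr h y
  exact h1.mul (tendsto_const_nhds.sub (h1.log (mixtureDensity_pos hr _ y).ne'))

/-- Fatou: the nonnegative integrands converge pointwise, and the reference measure is fixed. -/
lemma lintegral_deficit_le_liminf {r : ℝ} (hr : 0 < r)
    {ρ : ℕ → ProbabilityMeasure E} {ρ' : ProbabilityMeasure E} (h : Tendsto ρ atTop (𝓝 ρ')) :
    ∫⁻ y, ENNReal.ofReal (deficit r (ρ' : Measure E) y) ∂(stdGaussian E) ≤
      liminf (fun i ↦ ∫⁻ y, ENNReal.ofReal (deficit r (ρ i : Measure E) y) ∂(stdGaussian E))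
        atTop := by
  refine le_trans (le_of_eq ?_)
    (lintegral_liminf_le fun i ↦ (measurable_deficit r (ρ i : Measure E)).ennreal_ofReal)
  refine lintegral_congr fun y ↦ ?_
  exact (((ENNReal.continuous_ofReal.tendsto _).comp (tendsto_deficit hr h y)).liminf_eq).symm

end Smoothing

/-! ### Second moments under convolution -/

section SecondMoment

variable {E : Type*} [NormedAddCommGroup E] [InnerProductSpace ℝ E] [FiniteDimensional ℝ E]
  [MeasurableSpace E] [BorelSpace E]

/-- Second moments add up under convolution with a symmetric measure. -/
lemma lintegral_enorm_sq_conv {μ ν : Measure E} [IsProbabilityMeasure μ] [IsProbabilityMeasure ν]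
    (hν : ν.map (fun x ↦ -x) = ν) :
    ∫⁻ y, ‖y‖ₑ ^ 2 ∂(μ ∗ ν) = ∫⁻ x, ‖x‖ₑ ^ 2 ∂μ + ∫⁻ z, ‖z‖ₑ ^ 2 ∂ν := by
  rw [Measure.lintegral_conv (by fun_prop)]
  have h : ∀ x, ∫⁻ z, ‖x + z‖ₑ ^ 2 ∂ν = ‖x‖ₑ ^ 2 + ∫⁻ z, ‖z‖ₑ ^ 2 ∂ν := fun x ↦ by
    have h1 : ∫⁻ z, ‖x + z‖ₑ ^ 2 ∂ν = ∫⁻ z, ‖x - z‖ₑ ^ 2 ∂ν := by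
      conv_lhs => rw [← hν]
      rw [lintegral_map (by fun_prop) (by fun_prop)]
      simp only [sub_eq_add_neg]
    -- By symmetry of `ν` the cross term can be removed through the parallelogram law, without any
    -- integrability assumption.
    have h2 : ∀ z, ‖x + z‖ₑ ^ 2 + ‖x - z‖ₑ ^ 2 = 2 * (‖x‖ₑ ^ 2 + ‖z‖ₑ ^ 2) := fun z ↦ by
      have := parallelogram_law_with_norm ℝ x z
      simp only [← ofReal_norm, ← ENNReal.ofReal_pow (norm_nonneg _)]
      rw [← ENNReal.ofReal_add (by positivity) (by positivity),
        ← ENNReal.ofReal_add (by positivity) (by positivity), ← ENNReal.ofReal_ofNat 2,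
        ← ENNReal.ofReal_mul (by norm_num)]
      congr 1
    have h3 : 2 * ∫⁻ z, ‖x + z‖ₑ ^ 2 ∂ν = 2 * (‖x‖ₑ ^ 2 + ∫⁻ z, ‖z‖ₑ ^ 2 ∂ν) := by
      calc 2 * ∫⁻ z, ‖x + z‖ₑ ^ 2 ∂ν
          = ∫⁻ z, ‖x + z‖ₑ ^ 2 ∂ν + ∫⁻ z, ‖x - z‖ₑ ^ 2 ∂ν := by rw [← h1, two_mul]
        _ = ∫⁻ z, 2 * (‖x‖ₑ ^ 2 + ‖z‖ₑ ^ 2) ∂ν := by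
          rw [← lintegral_add_left (by fun_prop)]; simp_rw [h2]
        _ = _ := by
          rw [lintegral_const_mul _ (by fun_prop), lintegral_add_left (by fun_prop)]
          simp
    exact (ENNReal.mul_right_inj (by norm_num) (by norm_num)).1 h3
  simp_rw [h]
  rw [lintegral_add_right _ measurable_const]
  simp

lemma map_neg_map_stdGaussian {F : Type*} [NormedAddCommGroup F] [NormedSpace ℝ F]
    [MeasurableSpace F] [BorelSpace F] (L : E →L[ℝ] F) :
    ((stdGaussian E).map L).map (fun x ↦ -x) = (stdGaussian E).map L := by
  have h : (stdGaussian E).map (fun x ↦ -x) = stdGaussian E :=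
    stdGaussian_map (LinearIsometryEquiv.neg ℝ (E := E))
  conv_rhs => rw [← h]
  rw [Measure.map_map (by fun_prop) (by fun_prop), Measure.map_map (by fun_prop) (by fun_prop)]
  congr 1
  ext x
  simp

lemma lintegral_enorm_sq_stdGaussian_ne_top : ∫⁻ x, ‖x‖ₑ ^ 2 ∂(stdGaussian E) ≠ ∞ := by
  have h : MemLp id 2 (stdGaussian E) := IsGaussian.memLp_two_id
  have := lintegral_rpow_enorm_lt_top_of_eLpNorm_lt_top (by norm_num) (by norm_num) h.2
  simpa using this.ne

end SecondMoment

variable {𝒱 : Type*} [MeasurableSpace 𝒱] {dX dY : ℕ}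

/-! ### The Gaussian channel: measurability in `v`, continuity in the input, noise moments -/

section Channel

open scoped MatrixOrder

/-- The map `x ↦ A x` between Euclidean spaces. -/
noncomputable abbrev mulVecMap {m n : ℕ} (A : Matrix (Fin m) (Fin n) ℝ)
    (x : EuclideanSpace ℝ (Fin n)) : EuclideanSpace ℝ (Fin m) :=
  WithLp.toLp 2 (A *ᵥ x.ofLp)

lemma norm_mulVecMap_le {m n : ℕ} (A : Matrix (Fin m) (Fin n) ℝ) (x : EuclideanSpace ℝ (Fin n)) :
    ‖mulVecMap A x‖ ≤ ‖A‖ * ‖x‖ :=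
  Matrix.l2_opNorm_mulVec A x

lemma measurable_mulVecMap_uncurry {m n : ℕ} {M : 𝒱 → Matrix (Fin m) (Fin n) ℝ}
    (hM : ∀ i j, Measurable fun v ↦ M v i j) :
    Measurable fun p : 𝒱 × EuclideanSpace ℝ (Fin n) ↦ mulVecMap (M p.1) p.2 := by
  refine (WithLp.measurable_toLp 2 _).comp (measurable_pi_lambda _ fun i ↦ ?_)
  simp only [Matrix.mulVec, dotProduct]
  refine Finset.measurable_sum _ fun j _ ↦ ?_
  exact ((hM i j).comp measurable_fst).mul (by fun_prop)

lemma continuous_mulVecMap {m n : ℕ} (A : Matrix (Fin m) (Fin n) ℝ) :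
    Continuous (mulVecMap A) := by
  unfold mulVecMap
  fun_prop

/-- The quadratic form at `x` is `‖x‖² - ‖Aᵀ x‖²`, and `Aᵀ` is a contraction along with `A`. -/
lemma one_sub_mul_transpose_nonneg {A : Matrix (Fin dY) (Fin dX) ℝ} (hA : ‖A‖ ≤ 1) :
    0 ≤ 1 - A * Aᵀ := by
  rw [Matrix.nonneg_iff_posSemidef]
  refine Matrix.PosSemidef.of_dotProduct_mulVec_nonneg ?_ fun x ↦ ?_
  · simp [Matrix.IsHermitian, Matrix.transpose_mul]
  · have h1 : ‖mulVecMap Aᵀ (WithLp.toLp 2 x)‖ ≤ ‖(WithLp.toLp 2 x : EuclideanSpace ℝ (Fin dY))‖ := by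
      refine (norm_mulVecMap_le _ _).trans ?_
      have : ‖Aᵀ‖ = ‖A‖ := by simpa using Matrix.l2_opNorm_conjTranspose A
      rw [this]
      exact mul_le_of_le_one_left (norm_nonneg _) hA
    have h2 := pow_le_pow_left₀ (norm_nonneg _) h1 2
    rw [EuclideanSpace.real_norm_sq_eq, EuclideanSpace.real_norm_sq_eq] at h2
    have h3 : star x ⬝ᵥ ((1 - A * Aᵀ) *ᵥ x) = x ⬝ᵥ x - (Aᵀ *ᵥ x) ⬝ᵥ (Aᵀ *ᵥ x) := by
      rw [Matrix.sub_mulVec, Matrix.one_mulVec, dotProduct_sub, star_trivial,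
        ← Matrix.mulVec_mulVec, Matrix.dotProduct_mulVec x A, ← Matrix.mulVec_transpose]
    rw [h3]
    simp only [dotProduct, ← pow_two]
    simpa using h2

/-- The matrix square root is continuous on the positive semidefinite cone, so it is composed with a
measurable map into that cone, seen inside a product of copies of `ℝ`. -/
lemma measurable_sqrt_entry {n : ℕ} {S : 𝒱 → Matrix (Fin n) (Fin n) ℝ}
    (hS : ∀ i j, Measurable fun v ↦ S v i j) (hS0 : ∀ v, 0 ≤ S v) (i j : Fin n) :
    Measurable fun v ↦ CFC.sqrt (S v) i j := by
  let T : Set (Fin n → Fin n → ℝ) := {M | 0 ≤ (Matrix.of M)}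
  let s : 𝒱 → T := fun v ↦ ⟨fun i j ↦ S v i j, hS0 v⟩
  have hs : Measurable s :=
    (measurable_pi_lambda _ fun i ↦ measurable_pi_lambda _ fun j ↦ hS i j).subtype_mk
  have hc : Continuous fun M : T ↦ CFC.sqrt (Matrix.of M.1) i j := by
    have h1 : Continuous fun M : T ↦ CFC.sqrt (Matrix.of M.1) :=
      (CFC.continuousOn_sqrt (A := Matrix (Fin n) (Fin n) ℝ)).comp_continuous
        (by fun_prop) fun M ↦ M.2
    exact h1.matrix_elem i j
  exact hc.measurable.comp hs

/-- The constant is crude; only its independence of `A` matters, for bounding the noise moments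
uniformly in `v`. -/
lemma norm_sqrt_one_sub_le {A : Matrix (Fin dY) (Fin dX) ℝ} (hA : ‖A‖ ≤ 1) :
    ‖CFC.sqrt (1 - A * Aᵀ)‖ ≤ 2 := by
  rw [CFC.norm_sqrt _ (one_sub_mul_transpose_nonneg hA)]
  have h1 : ‖(1 : Matrix (Fin dY) (Fin dY) ℝ)‖ ≤ 1 := by
    rw [← Matrix.diagonal_one, Matrix.l2_opNorm_diagonal]
    exact (pi_norm_le_iff_of_nonneg zero_le_one).2 fun i ↦ by simp
  have h2 : ‖A * Aᵀ‖ ≤ 1 := by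
    have h3 : ‖Aᵀ‖ = ‖A‖ := by simpa using Matrix.l2_opNorm_conjTranspose A
    calc ‖A * Aᵀ‖ ≤ ‖A‖ * ‖Aᵀ‖ := Matrix.l2_opNorm_mul _ _
      _ ≤ 1 := by rw [h3]; exact mul_le_one₀ hA (norm_nonneg _) hA
  have h4 : ‖1 - A * Aᵀ‖ ≤ 4 := (norm_sub_le _ _).trans (by linarith)
  exact Real.sqrt_le_iff.2 ⟨by norm_num, h4.trans (by norm_num)⟩

lemma multivariateGaussian_zero_eq_map {n : ℕ} (S : Matrix (Fin n) (Fin n) ℝ) :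
    multivariateGaussian 0 S =
      (stdGaussian (EuclideanSpace ℝ (Fin n))).map (mulVecMap (CFC.sqrt S)) := by
  simp only [multivariateGaussian, zero_add]
  rfl

lemma multivariateGaussian_smul_one {n : ℕ} {δ : ℝ} (hδ : 0 < δ) :
    multivariateGaussian 0 (δ • (1 : Matrix (Fin n) (Fin n) ℝ)) =
      (stdGaussian (EuclideanSpace ℝ (Fin n))).map fun w ↦ √δ • w := by
  have h : CFC.sqrt (δ • (1 : Matrix (Fin n) (Fin n) ℝ)) = √δ • 1 := by
    refine CFC.sqrt_unique ?_ ?_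
    · rw [smul_mul_smul_comm, Real.mul_self_sqrt hδ.le, one_mul]
    · exact smul_nonneg (Real.sqrt_nonneg _) zero_le_one
  rw [multivariateGaussian_zero_eq_map, h]
  congr 1
  ext w i
  simp [Matrix.smul_mulVec]

lemma map_neg_multivariateGaussian {n : ℕ} (S : Matrix (Fin n) (Fin n) ℝ) :
    (multivariateGaussian 0 S).map (fun x ↦ -x) = multivariateGaussian 0 S := by
  simp only [multivariateGaussian, zero_add]
  exact map_neg_map_stdGaussian (Matrix.toEuclideanCLM (𝕜 := ℝ) (CFC.sqrt S))

instance isProbabilityMeasure_map_mulVecMap (A : Matrix (Fin dY) (Fin dX) ℝ)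
    (Q : Measure (EuclideanSpace ℝ (Fin dX))) [IsProbabilityMeasure Q] :
    IsProbabilityMeasure (Q.map fun x ↦ WithLp.toLp 2 (A *ᵥ x.ofLp)) :=
  Measure.isProbabilityMeasure_map (continuous_mulVecMap A).aemeasurable

instance isProbabilityMeasure_outputLaw (A : Matrix (Fin dY) (Fin dX) ℝ)
    (Q : Measure (EuclideanSpace ℝ (Fin dX))) [IsProbabilityMeasure Q] :
    IsProbabilityMeasure (outputLaw A Q) := by
  unfold outputLaw; infer_instance

/-- The measure pushed forward no longer depends on `A`, so measurability in `v` reduces to joint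
measurability of the map. -/
lemma outputLaw_eq_map_prod (A : Matrix (Fin dY) (Fin dX) ℝ)
    (Q : Measure (EuclideanSpace ℝ (Fin dX))) [IsProbabilityMeasure Q] :
    outputLaw A Q = (Q.prod (stdGaussian (EuclideanSpace ℝ (Fin dY)))).map
      fun p ↦ mulVecMap A p.1 + mulVecMap (CFC.sqrt (1 - A * Aᵀ)) p.2 := by
  have h1 := (continuous_mulVecMap A).measurable
  have h2 := (continuous_mulVecMap (CFC.sqrt (1 - A * Aᵀ))).measurable
  rw [outputLaw, multivariateGaussian_zero_eq_map, Measure.conv,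
    Measure.map_prod_map _ _ h1 h2, Measure.map_map (by fun_prop) (h1.prodMap h2)]
  rfl

lemma measurable_one_sub_mul_transpose {A : 𝒱 → Matrix (Fin dY) (Fin dX) ℝ}
    (hA : ∀ i j, Measurable fun v ↦ A v i j) (i j : Fin dY) :
    Measurable fun v ↦ ((1 : Matrix (Fin dY) (Fin dY) ℝ) - A v * (A v)ᵀ) i j := by
  simp only [Matrix.sub_apply, Matrix.mul_apply, Matrix.transpose_apply]
  exact measurable_const.sub (Finset.measurable_sum _ fun k _ ↦ (hA i k).mul (hA j k))

lemma measurable_map_of_measurable_uncurry {Z F : Type*} [MeasurableSpace Z] [MeasurableSpace F]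
    {T : 𝒱 × Z → F} (hT : Measurable T) (μ : Measure Z) [SFinite μ] :
    Measurable fun v ↦ μ.map fun z ↦ T (v, z) := by
  refine Measure.measurable_of_measurable_coe _ fun s hs ↦ ?_
  have h : ∀ v, (μ.map fun z ↦ T (v, z)) s = μ (Prod.mk v ⁻¹' (T ⁻¹' s)) := fun v ↦
    Measure.map_apply (hT.comp measurable_prodMk_left) hs
  simp_rw [h]
  exact measurable_measure_prodMk_left (hT hs)

lemma measurable_mulVecMap_add_mulVecMap {k m n : ℕ} {A : 𝒱 → Matrix (Fin k) (Fin m) ℝ}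
    {B : 𝒱 → Matrix (Fin k) (Fin n) ℝ} (hA : ∀ i j, Measurable fun v ↦ A v i j)
    (hB : ∀ i j, Measurable fun v ↦ B v i j) :
    Measurable fun p : 𝒱 × (EuclideanSpace ℝ (Fin m) × EuclideanSpace ℝ (Fin n)) ↦
      mulVecMap (A p.1) p.2.1 + mulVecMap (B p.1) p.2.2 :=
  ((measurable_mulVecMap_uncurry hA).comp
      (measurable_fst.prodMk (measurable_fst.comp measurable_snd))).add
    ((measurable_mulVecMap_uncurry hB).comp
      (measurable_fst.prodMk (measurable_snd.comp measurable_snd)))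

lemma measurable_outputLaw {A : 𝒱 → Matrix (Fin dY) (Fin dX) ℝ}
    (hA : ∀ i j, Measurable fun v ↦ A v i j) (hA1 : ∀ v, ‖A v‖ ≤ 1)
    (Q : Measure (EuclideanSpace ℝ (Fin dX))) [IsProbabilityMeasure Q] :
    Measurable fun v ↦ outputLaw (A v) Q := by
  have hB := measurable_sqrt_entry (measurable_one_sub_mul_transpose hA)
    fun v ↦ one_sub_mul_transpose_nonneg (hA1 v)
  have h := measurable_map_of_measurable_uncurry (measurable_mulVecMap_add_mulVecMap hA hB)
    (Q.prod (stdGaussian (EuclideanSpace ℝ (Fin dY))))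
  simpa only [outputLaw_eq_map_prod] using h

/-- `outputLaw` as a probability measure. -/
noncomputable def outputProb (A : Matrix (Fin dY) (Fin dX) ℝ)
    (Q : ProbabilityMeasure (EuclideanSpace ℝ (Fin dX))) :
    ProbabilityMeasure (EuclideanSpace ℝ (Fin dY)) :=
  ⟨outputLaw A (Q : Measure _), inferInstance⟩

lemma coe_outputProb (A : Matrix (Fin dY) (Fin dX) ℝ)
    (Q : ProbabilityMeasure (EuclideanSpace ℝ (Fin dX))) :
    (outputProb A Q : Measure _) = outputLaw A (Q : Measure _) := rfl

/-- Convolving with fixed noise multiplies characteristic functions by a fixed factor, so their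
pointwise convergence is preserved. -/
lemma tendsto_outputProb (A : Matrix (Fin dY) (Fin dX) ℝ)
    {Q : ℕ → ProbabilityMeasure (EuclideanSpace ℝ (Fin dX))}
    {Qstar : ProbabilityMeasure (EuclideanSpace ℝ (Fin dX))} (hQ : Tendsto Q atTop (𝓝 Qstar)) :
    Tendsto (fun i ↦ outputProb A (Q i)) atTop (𝓝 (outputProb A Qstar)) := by
  have h := ProbabilityMeasure.tendsto_map_of_tendsto_of_continuous _ _ hQ
    (continuous_mulVecMap A)
  rw [ProbabilityMeasure.tendsto_iff_tendsto_charFun] at h ⊢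
  intro t
  simp only [outputProb, ProbabilityMeasure.coe_mk, outputLaw, charFun_conv]
  exact (h t).mul_const _

lemma lintegral_enorm_sq_smoothedOutputLaw (δ : ℝ) (A : Matrix (Fin dY) (Fin dX) ℝ)
    (Q : Measure (EuclideanSpace ℝ (Fin dX))) [IsProbabilityMeasure Q] :
    ∫⁻ y, ‖y‖ₑ ^ 2 ∂(smoothedOutputLaw δ A Q) = ∫⁻ x, ‖mulVecMap A x‖ₑ ^ 2 ∂Q +
      (∫⁻ z, ‖z‖ₑ ^ 2 ∂(multivariateGaussian 0 (1 - A * Aᵀ)) +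
        ∫⁻ z, ‖z‖ₑ ^ 2 ∂(multivariateGaussian 0 (δ • (1 : Matrix (Fin dY) (Fin dY) ℝ)))) := by
  rw [smoothedOutputLaw, lintegral_enorm_sq_conv (map_neg_multivariateGaussian _), outputLaw,
    lintegral_enorm_sq_conv (map_neg_multivariateGaussian _),
    lintegral_map (by fun_prop) (continuous_mulVecMap A).measurable, add_assoc]

lemma lintegral_enorm_sq_multivariateGaussian_le {n : ℕ} (S : Matrix (Fin n) (Fin n) ℝ) :
    ∫⁻ z, ‖z‖ₑ ^ 2 ∂(multivariateGaussian 0 S) ≤ ‖CFC.sqrt S‖ₑ ^ 2 *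
      ∫⁻ w, ‖w‖ₑ ^ 2 ∂(stdGaussian (EuclideanSpace ℝ (Fin n))) := by
  rw [multivariateGaussian_zero_eq_map,
    lintegral_map (by fun_prop) (continuous_mulVecMap _).measurable,
    ← lintegral_const_mul _ (by fun_prop)]
  refine lintegral_mono fun w ↦ ?_
  rw [← mul_pow]
  gcongr
  simp only [← ofReal_norm]
  rw [← ENNReal.ofReal_mul (norm_nonneg _)]
  exact ENNReal.ofReal_le_ofReal (norm_mulVecMap_le _ _)

lemma lintegral_enorm_sq_multivariateGaussian_ne_top {n : ℕ} (S : Matrix (Fin n) (Fin n) ℝ) :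
    ∫⁻ z, ‖z‖ₑ ^ 2 ∂(multivariateGaussian 0 S) ≠ ∞ :=
  ne_top_of_le_ne_top (ENNReal.mul_ne_top (ENNReal.pow_ne_top enorm_ne_top)
    lintegral_enorm_sq_stdGaussian_ne_top) (lintegral_enorm_sq_multivariateGaussian_le S)

lemma lintegral_enorm_sq_multivariateGaussian_one_sub_le {A : Matrix (Fin dY) (Fin dX) ℝ}
    (hA : ‖A‖ ≤ 1) : ∫⁻ z, ‖z‖ₑ ^ 2 ∂(multivariateGaussian 0 (1 - A * Aᵀ)) ≤
      ENNReal.ofReal 2 ^ 2 *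
        ∫⁻ w, ‖w‖ₑ ^ 2 ∂(stdGaussian (EuclideanSpace ℝ (Fin dY))) := by
  refine (lintegral_enorm_sq_multivariateGaussian_le _).trans ?_
  gcongr
  rw [← ofReal_norm]
  exact ENNReal.ofReal_le_ofReal (norm_sqrt_one_sub_le hA)

end Channel

/-! ### The averaged quadratic form -/

section QuadraticForm

/-- The quadratic form `x ↦ ⟨x, E_V[A_Vᵀ A_V] x⟩`. -/
noncomputable def meanQuad (PV : Measure 𝒱) (A : 𝒱 → Matrix (Fin dY) (Fin dX) ℝ)
    (x : EuclideanSpace ℝ (Fin dX)) : ℝ :=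
  inner ℝ x (mulVecMap (meanGram PV A) x)

lemma continuous_meanQuad (PV : Measure 𝒱) (A : 𝒱 → Matrix (Fin dY) (Fin dX) ℝ) :
    Continuous (meanQuad PV A) :=
  continuous_id.inner (continuous_mulVecMap _)

lemma meanQuad_le (PV : Measure 𝒱) (A : 𝒱 → Matrix (Fin dY) (Fin dX) ℝ)
    (x : EuclideanSpace ℝ (Fin dX)) : meanQuad PV A x ≤ sStar PV A * ‖x‖ ^ 2 := by
  refine (real_inner_le_norm _ _).trans ?_
  have := mul_le_mul_of_nonneg_left (norm_mulVecMap_le (meanGram PV A) x) (norm_nonneg x)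
  rw [sStar]
  linarith

lemma abs_entry_le {A : Matrix (Fin dY) (Fin dX) ℝ} (hA : ‖A‖ ≤ 1) (i : Fin dY) (j : Fin dX) :
    |A i j| ≤ 1 := by
  have h := norm_mulVecMap_le A (EuclideanSpace.single j 1)
  have h2 := PiLp.norm_apply_le (mulVecMap A (EuclideanSpace.single j 1)) i
  simp [mulVecMap] at h h2
  linarith

lemma integrable_and_integral_norm_sq_mulVecMap (PV : Measure 𝒱) [IsProbabilityMeasure PV]
    {A : 𝒱 → Matrix (Fin dY) (Fin dX) ℝ}
    (hA : ∀ i j, Measurable fun v ↦ A v i j) (hA1 : ∀ v, ‖A v‖ ≤ 1)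
    (x : EuclideanSpace ℝ (Fin dX)) :
    Integrable (fun v ↦ ‖mulVecMap (A v) x‖ ^ 2) PV ∧
      ∫ v, ‖mulVecMap (A v) x‖ ^ 2 ∂PV = meanQuad PV A x := by
  have hent : ∀ i j, Integrable (fun v ↦ ((A v)ᵀ * A v) i j) PV := fun i j ↦ by
    simp only [Matrix.mul_apply, Matrix.transpose_apply]
    refine integrable_finsetSum _ fun k _ ↦ ?_
    refine Integrable.of_bound ((hA k i).mul (hA k j)).aestronglyMeasurable 1
      (ae_of_all _ fun v ↦ ?_)
    rw [Real.norm_eq_abs, abs_mul]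
    exact mul_le_one₀ (abs_entry_le (hA1 v) _ _) (abs_nonneg _) (abs_entry_le (hA1 v) _ _)
  have hsq : ∀ v, ‖mulVecMap (A v) x‖ ^ 2 =
      ∑ i, ∑ j, x i * (((A v)ᵀ * A v) i j * x j) := fun v ↦ by
    rw [← real_inner_self_eq_norm_sq, EuclideanSpace.inner_eq_star_dotProduct]
    simp only [star_trivial]
    rw [Matrix.dotProduct_mulVec, ← Matrix.mulVec_transpose, Matrix.mulVec_mulVec, dotProduct_comm]
    simp only [dotProduct, Matrix.mulVec, Finset.mul_sum]
  have hint : Integrable (fun v ↦ ‖mulVecMap (A v) x‖ ^ 2) PV := by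
    simp_rw [hsq]
    exact integrable_finsetSum _ fun i _ ↦ integrable_finsetSum _ fun j _ ↦
      ((hent i j).mul_const _).const_mul _
  refine ⟨hint, ?_⟩
  simp_rw [hsq]
  rw [integral_finsetSum _ fun i _ ↦ integrable_finsetSum _ fun j _ ↦
    ((hent i j).mul_const _).const_mul _]
  rw [meanQuad, EuclideanSpace.inner_eq_star_dotProduct, dotProduct_comm]
  simp only [star_trivial, dotProduct, Matrix.mulVec, Finset.mul_sum]
  refine Finset.sum_congr rfl fun i _ ↦ ?_
  rw [integral_finsetSum _ fun j _ ↦ ((hent i j).mul_const _).const_mul _]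
  refine Finset.sum_congr rfl fun j _ ↦ ?_
  rw [integral_const_mul, integral_mul_const, meanGram, Matrix.of_apply]

lemma lintegral_enorm_sq_mulVecMap (PV : Measure 𝒱) [IsProbabilityMeasure PV]
    {A : 𝒱 → Matrix (Fin dY) (Fin dX) ℝ}
    (hA : ∀ i j, Measurable fun v ↦ A v i j) (hA1 : ∀ v, ‖A v‖ ≤ 1)
    (x : EuclideanSpace ℝ (Fin dX)) :
    ∫⁻ v, ‖mulVecMap (A v) x‖ₑ ^ 2 ∂PV = ENNReal.ofReal (meanQuad PV A x) := by
  obtain ⟨hint, hval⟩ := integrable_and_integral_norm_sq_mulVecMap PV hA hA1 x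
  rw [← hval, ofReal_integral_eq_lintegral_ofReal hint (ae_of_all _ fun v ↦ by positivity)]
  refine lintegral_congr fun v ↦ ?_
  rw [ENNReal.ofReal_pow (norm_nonneg _), ofReal_norm]

lemma meanQuad_nonneg (PV : Measure 𝒱) [IsProbabilityMeasure PV]
    {A : 𝒱 → Matrix (Fin dY) (Fin dX) ℝ}
    (hA : ∀ i j, Measurable fun v ↦ A v i j) (hA1 : ∀ v, ‖A v‖ ≤ 1)
    (x : EuclideanSpace ℝ (Fin dX)) : 0 ≤ meanQuad PV A x := by
  rw [← (integrable_and_integral_norm_sq_mulVecMap PV hA hA1 x).2]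
  exact integral_nonneg fun v ↦ by positivity

end QuadraticForm

/-! ### Arithmetic of extended reals -/

section ExtendedReals

lemma ennreal_liminf_add_liminf_le (u v : ℕ → ℝ≥0∞) :
    liminf u atTop + liminf v atTop ≤ liminf (fun i ↦ u i + v i) atTop := by
  simp only [liminf_eq_iSup_iInf_of_nat]
  rw [ENNReal.iSup_add_iSup_of_monotone]
  · exact iSup_mono fun n ↦ le_iInf₂ fun i hi ↦ add_le_add (iInf₂_le i hi) (iInf₂_le i hi)
  all_goals exact fun m n hmn ↦ le_iInf₂ fun i hi ↦ iInf₂_le i (hmn.trans hi)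

lemma ennreal_mul_liminf_le {c : ℝ≥0∞} (hc : c ≠ ∞) (u : ℕ → ℝ≥0∞) :
    c * liminf u atTop ≤ liminf (fun i ↦ c * u i) atTop :=
  (ENNReal.liminf_const_mul_of_ne_top hc).ge

/-- Identities are proved additively in `ℝ≥0∞` and turned into differences only here; finiteness of
`κ` and `d` forces `x` and `g` to be infinite simultaneously. -/
lemma ereal_sub_eq_sub_of_add_eq_add {x κ g d : ℝ≥0∞} (hκ : κ ≠ ∞) (hd : d ≠ ∞)
    (h : x + κ = g + d) : (x : EReal) - d = (g : EReal) - κ.toReal := by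
  lift κ to NNReal using hκ
  lift d to NNReal using hd
  by_cases hx : x = ∞
  · subst hx
    have hg : g = ∞ := by
      by_contra hg
      have : g + (d : ℝ≥0∞) ≠ ∞ := ENNReal.add_ne_top.2 ⟨hg, ENNReal.coe_ne_top⟩
      exact this (by rw [← h]; simp)
    subst hg
    simp only [EReal.coe_ennreal_top, ENNReal.coe_toReal]
    rw [EReal.top_sub_coe, show ((d : ℝ≥0∞) : EReal) = ((d : ℝ) : EReal) from rfl,
      EReal.top_sub_coe]
  · have hg : g ≠ ∞ := by
      rintro rfl
      have : x + (κ : ℝ≥0∞) ≠ ∞ := ENNReal.add_ne_top.2 ⟨hx, ENNReal.coe_ne_top⟩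
      exact this (by rw [h]; simp)
    lift x to NNReal using hx
    lift g to NNReal using hg
    have h' : (x : ℝ) + κ = g + d := by exact_mod_cast h
    change ((x : ℝ) : EReal) - ((d : ℝ) : EReal) = ((g : ℝ) : EReal) - ((κ : ℝ) : EReal)
    rw [← EReal.coe_sub, ← EReal.coe_sub]
    congr 1
    linarith

lemma ereal_le_of_forall_sub_le {a l : EReal} {c : ℝ}
    (h : ∀ ε : ℝ, 0 < ε → ε ≤ 1 → a - ((c * ε : ℝ) : EReal) ≤ l) : a ≤ l := by
  have h1 : Tendsto (fun n : ℕ ↦ -(c * (1 / ((n : ℝ) + 1)))) atTop (𝓝 0) := by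
    simpa using (tendsto_one_div_add_atTop_nhds_zero_nat (𝕜 := ℝ)).const_mul c |>.neg
  have h2 : Tendsto (fun n : ℕ ↦ a + ((-(c * (1 / ((n : ℝ) + 1))) : ℝ) : EReal)) atTop
      (𝓝 (a + ((0 : ℝ) : EReal))) := by
    have h3 := (EReal.continuousAt_add (p := (a, ((0 : ℝ) : EReal))) (Or.inr (by simp))
      (Or.inr (by simp))).tendsto
    exact h3.comp (tendsto_const_nhds.prodMk_nhds
      ((continuous_coe_real_ereal.tendsto _).comp h1))
  rw [EReal.coe_zero, add_zero] at h2
  refine le_of_tendsto' h2 fun n ↦ ?_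
  have := h (1 / ((n : ℝ) + 1)) (by positivity)
    (by rw [div_le_one (by positivity)]; linarith [n.cast_nonneg (α := ℝ)])
  rwa [sub_eq_add_neg, ← EReal.coe_neg] at this

end ExtendedReals

/-! ### Splitting the functional into a lower semicontinuous part and controlled terms -/

section Decomposition

/-- The conditional entropy deficit of the smoothed output law. -/
noncomputable def outputDeficit (PV : Measure 𝒱) (A : 𝒱 → Matrix (Fin dY) (Fin dX) ℝ) (δ : ℝ)
    (Q : Measure (EuclideanSpace ℝ (Fin dX))) : ℝ≥0∞ :=
  ∫⁻ v, ∫⁻ y, ENNReal.ofReal (deficit (√δ) (outputLaw (A v) Q) y)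
    ∂(stdGaussian (EuclideanSpace ℝ (Fin dY))) ∂PV

/-- The part of the second moment of the smoothed output law that is due to the noise. -/
noncomputable def noiseMoment (A : Matrix (Fin dY) (Fin dX) ℝ) (δ : ℝ) : ℝ≥0∞ :=
  ∫⁻ z, ‖z‖ₑ ^ 2 ∂(multivariateGaussian 0 (1 - A * Aᵀ)) +
    ∫⁻ z, ‖z‖ₑ ^ 2 ∂(multivariateGaussian 0 (δ • (1 : Matrix (Fin dY) (Fin dY) ℝ)))

/-- The part of `outputDiv + outputDeficit` that does not depend on the input law. -/
noncomputable def noiseConst (PV : Measure 𝒱) (A : 𝒱 → Matrix (Fin dY) (Fin dX) ℝ) (δ : ℝ) :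
    ℝ≥0∞ :=
  ENNReal.ofReal (logBound (EuclideanSpace ℝ (Fin dY)) (√δ)) +
    2⁻¹ * ∫⁻ v, noiseMoment (A v) δ ∂PV

/-- The excess `E[(s ‖X‖² - ⟨X, E_V[A_Vᵀ A_V] X⟩) / 2]`. -/
noncomputable def quadExcess (PV : Measure 𝒱) (A : 𝒱 → Matrix (Fin dY) (Fin dX) ℝ) (s : ℝ)
    (Q : Measure (EuclideanSpace ℝ (Fin dX))) : ℝ≥0∞ :=
  ∫⁻ x, ENNReal.ofReal (s / 2 * ‖x‖ ^ 2 - 1 / 2 * meanQuad PV A x) ∂Q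

lemma quadExcess_integrand_nonneg {PV : Measure 𝒱} {A : 𝒱 → Matrix (Fin dY) (Fin dX) ℝ} {s : ℝ}
    (hs : sStar PV A ≤ s) (x : EuclideanSpace ℝ (Fin dX)) :
    0 ≤ s / 2 * ‖x‖ ^ 2 - 1 / 2 * meanQuad PV A x := by
  have h1 := meanQuad_le PV A x
  have h2 := mul_le_mul_of_nonneg_right hs (sq_nonneg ‖x‖)
  linarith

/-- Portmanteau for a nonnegative continuous integrand. This is where `s ≥ s⋆` enters: it supplies
the sign. -/
lemma quadExcess_le_liminf {PV : Measure 𝒱} {A : 𝒱 → Matrix (Fin dY) (Fin dX) ℝ} {s : ℝ}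
    (hs : sStar PV A ≤ s)
    {Q : ℕ → ProbabilityMeasure (EuclideanSpace ℝ (Fin dX))}
    {Qstar : ProbabilityMeasure (EuclideanSpace ℝ (Fin dX))} (hQ : Tendsto Q atTop (𝓝 Qstar)) :
    quadExcess PV A s (Qstar : Measure _) ≤
      liminf (fun i ↦ quadExcess PV A s (Q i : Measure _)) atTop := by
  have hc := continuous_meanQuad PV A
  exact lintegral_le_liminf_lintegral_of_forall_isOpen_measure_le_liminf_measure
    (f := fun x ↦ s / 2 * ‖x‖ ^ 2 - 1 / 2 * meanQuad PV A x) (by fun_prop)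
    (quadExcess_integrand_nonneg hs)
    fun G hG ↦ ProbabilityMeasure.le_liminf_measure_open_of_tendsto hQ hG

variable {PV : Measure 𝒱} [IsProbabilityMeasure PV] {A : 𝒱 → Matrix (Fin dY) (Fin dX) ℝ}

lemma noiseConst_ne_top (hA1 : ∀ v, ‖A v‖ ≤ 1) (δ : ℝ) : noiseConst PV A δ ≠ ∞ := by
  have h : ∫⁻ v, noiseMoment (A v) δ ∂PV ≤
      ENNReal.ofReal 2 ^ 2 * ∫⁻ w, ‖w‖ₑ ^ 2 ∂(stdGaussian (EuclideanSpace ℝ (Fin dY))) +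
        ∫⁻ z, ‖z‖ₑ ^ 2 ∂(multivariateGaussian 0 (δ • (1 : Matrix (Fin dY) (Fin dY) ℝ))) := by
    refine (lintegral_mono fun v ↦ add_le_add_left
      (lintegral_enorm_sq_multivariateGaussian_one_sub_le (hA1 v)) _).trans ?_
    rw [lintegral_const, measure_univ, mul_one]
  refine ENNReal.add_ne_top.2 ⟨ENNReal.ofReal_ne_top,
    ENNReal.mul_ne_top (by simp) (ne_top_of_le_ne_top (ENNReal.add_ne_top.2 ⟨?_, ?_⟩) h)⟩
  · exact ENNReal.mul_ne_top (ENNReal.pow_ne_top ENNReal.ofReal_ne_top)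
      lintegral_enorm_sq_stdGaussian_ne_top
  · exact lintegral_enorm_sq_multivariateGaussian_ne_top _

lemma measurable_lintegral_deficit (hA : ∀ i j, Measurable fun v ↦ A v i j)
    (hA1 : ∀ v, ‖A v‖ ≤ 1) (δ : ℝ) (Q : Measure (EuclideanSpace ℝ (Fin dX)))
    [IsProbabilityMeasure Q] :
    Measurable fun v ↦ ∫⁻ y, ENNReal.ofReal (deficit (√δ) (outputLaw (A v) Q) y)
      ∂(stdGaussian (EuclideanSpace ℝ (Fin dY))) :=
  (measurable_deficit_uncurry (√δ) (measurable_outputLaw hA hA1 Q)).ennreal_ofReal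
    |>.lintegral_prod_right'

/-- Average the fixed-`v` deficit identity over `v`; Tonelli turns the mean of `‖A_v x‖²` into the
quadratic form of `E[AᵀA]`. -/
lemma outputDiv_add_outputDeficit (hA : ∀ i j, Measurable fun v ↦ A v i j)
    (hA1 : ∀ v, ‖A v‖ ≤ 1) {δ : ℝ} (hδ : 0 < δ) (Q : Measure (EuclideanSpace ℝ (Fin dX)))
    [IsProbabilityMeasure Q] :
    outputDiv PV A δ Q + outputDeficit PV A δ Q =
      noiseConst PV A δ + 2⁻¹ * ∫⁻ x, ENNReal.ofReal (meanQuad PV A x) ∂Q := by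
  have h1 : ∀ v, klDiv (smoothedOutputLaw δ (A v) Q) (stdGaussian (EuclideanSpace ℝ (Fin dY))) +
      ∫⁻ y, ENNReal.ofReal (deficit (√δ) (outputLaw (A v) Q) y)
        ∂(stdGaussian (EuclideanSpace ℝ (Fin dY))) =
      (ENNReal.ofReal (logBound (EuclideanSpace ℝ (Fin dY)) (√δ)) +
        2⁻¹ * ∫⁻ x, ‖mulVecMap (A v) x‖ₑ ^ 2 ∂Q) + 2⁻¹ * noiseMoment (A v) δ := fun v ↦ by
    have h := klDiv_conv_add_lintegral_deficit (Real.sqrt_pos.2 hδ) (outputLaw (A v) Q)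
    rw [← multivariateGaussian_smul_one hδ] at h
    rw [smoothedOutputLaw, h, ← smoothedOutputLaw, lintegral_enorm_sq_smoothedOutputLaw, mul_add,
      add_assoc, noiseMoment]
  have hm : Measurable fun p : 𝒱 × EuclideanSpace ℝ (Fin dX) ↦ ‖mulVecMap (A p.1) p.2‖ₑ ^ 2 :=
    (measurable_mulVecMap_uncurry hA).enorm.pow_const 2
  have hm1 : Measurable fun v ↦ ∫⁻ x, ‖mulVecMap (A v) x‖ₑ ^ 2 ∂Q := hm.lintegral_prod_right'
  have hm2 : Measurable fun v ↦ ENNReal.ofReal (logBound (EuclideanSpace ℝ (Fin dY)) (√δ)) +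
      2⁻¹ * ∫⁻ x, ‖mulVecMap (A v) x‖ₑ ^ 2 ∂Q := measurable_const.add (hm1.const_mul _)
  rw [outputDiv, outputDeficit, ← lintegral_add_right _ (measurable_lintegral_deficit hA hA1 δ Q)]
  simp_rw [h1]
  rw [lintegral_add_left hm2, lintegral_add_left measurable_const, lintegral_const_mul _ hm1,
    lintegral_const_mul' _ _ (by simp),
    lintegral_lintegral_swap hm.aemeasurable, lintegral_const, measure_univ, mul_one, noiseConst]
  simp_rw [lintegral_enorm_sq_mulVecMap PV hA hA1]
  ring

lemma outputDeficit_le_liminf (hA : ∀ i j, Measurable fun v ↦ A v i j)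
    (hA1 : ∀ v, ‖A v‖ ≤ 1) {δ : ℝ} (hδ : 0 < δ)
    {Q : ℕ → ProbabilityMeasure (EuclideanSpace ℝ (Fin dX))}
    {Qstar : ProbabilityMeasure (EuclideanSpace ℝ (Fin dX))} (hQ : Tendsto Q atTop (𝓝 Qstar)) :
    outputDeficit PV A δ (Qstar : Measure _) ≤
      liminf (fun i ↦ outputDeficit PV A δ (Q i : Measure _)) atTop := by
  have h : ∀ v, ∫⁻ y, ENNReal.ofReal (deficit (√δ) (outputLaw (A v) (Qstar : Measure _)) y)
        ∂(stdGaussian (EuclideanSpace ℝ (Fin dY))) ≤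
      liminf (fun i ↦ ∫⁻ y, ENNReal.ofReal (deficit (√δ) (outputLaw (A v) (Q i : Measure _)) y)
        ∂(stdGaussian (EuclideanSpace ℝ (Fin dY)))) atTop := fun v ↦ by
    have := lintegral_deficit_le_liminf (Real.sqrt_pos.2 hδ) (tendsto_outputProb (A v) hQ)
    simpa only [coe_outputProb] using this
  simp only [outputDeficit]
  exact (lintegral_mono h).trans
    (lintegral_liminf_le fun i ↦ measurable_lintegral_deficit hA hA1 δ (Q i : Measure _))

lemma lintegral_ofReal_mul_norm_sq {E : Type*} [NormedAddCommGroup E] [MeasurableSpace E]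
    [BorelSpace E] {c : ℝ} (hc : 0 ≤ c) (Q : Measure E) :
    ∫⁻ x, ENNReal.ofReal (c * ‖x‖ ^ 2) ∂Q = ENNReal.ofReal c * ∫⁻ x, ‖x‖ₑ ^ 2 ∂Q := by
  rw [← lintegral_const_mul _ (by fun_prop)]
  refine lintegral_congr fun x ↦ ?_
  rw [ENNReal.ofReal_mul hc, ENNReal.ofReal_pow (norm_nonneg _), ofReal_norm]

lemma quadExcess_add (hA : ∀ i j, Measurable fun v ↦ A v i j) (hA1 : ∀ v, ‖A v‖ ≤ 1)
    {s : ℝ} (hs : sStar PV A ≤ s) (Q : Measure (EuclideanSpace ℝ (Fin dX))) :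
    quadExcess PV A s Q + 2⁻¹ * ∫⁻ x, ENNReal.ofReal (meanQuad PV A x) ∂Q =
      ENNReal.ofReal (s / 2) * ∫⁻ x, ‖x‖ₑ ^ 2 ∂Q := by
  have hs0 : 0 ≤ s := (norm_nonneg _).trans hs
  have hc := continuous_meanQuad PV A
  rw [← lintegral_ofReal_mul_norm_sq (by positivity), quadExcess,
    ← lintegral_const_mul _ hc.measurable.ennreal_ofReal,
    ← lintegral_add_right _ (hc.measurable.ennreal_ofReal.const_mul _)]
  refine lintegral_congr fun x ↦ ?_
  have h2 : (2⁻¹ : ℝ≥0∞) = ENNReal.ofReal (1 / 2) := by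
    rw [one_div, ENNReal.ofReal_inv_of_pos (by norm_num), ENNReal.ofReal_ofNat]
  have h3 := meanQuad_nonneg PV hA hA1 x
  rw [h2, ← ENNReal.ofReal_mul (by norm_num),
    ← ENNReal.ofReal_add (quadExcess_integrand_nonneg hs x) (by positivity)]
  congr 1
  ring

lemma lintegral_enorm_sq_le_liminf {E : Type*} [NormedAddCommGroup E] [MeasurableSpace E]
    [BorelSpace E] {Q : ℕ → ProbabilityMeasure E} {Qstar : ProbabilityMeasure E}
    (hQ : Tendsto Q atTop (𝓝 Qstar)) :
    ∫⁻ x, ‖x‖ₑ ^ 2 ∂(Qstar : Measure E) ≤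
      liminf (fun i ↦ ∫⁻ x, ‖x‖ₑ ^ 2 ∂(Q i : Measure E)) atTop := by
  have h := lintegral_le_liminf_lintegral_of_forall_isOpen_measure_le_liminf_measure
    (f := fun x : E ↦ 1 * ‖x‖ ^ 2) (by fun_prop) (fun x ↦ by positivity)
    fun G hG ↦ ProbabilityMeasure.le_liminf_measure_open_of_tendsto hQ hG
  simp only [lintegral_ofReal_mul_norm_sq zero_le_one] at h
  simpa only [ENNReal.ofReal_one, one_mul] using h

/-- The standard Gaussian tilted towards a larger variance, `N(0, ε⁻¹ I)`. -/
noncomputable def wideGaussian (d : ℕ) (ε : ℝ) : Measure (EuclideanSpace ℝ (Fin d)) :=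
  (stdGaussian (EuclideanSpace ℝ (Fin d))).tilted fun x ↦ (1 - ε) / 2 * ‖x‖ ^ 2

lemma isProbabilityMeasure_wideGaussian (d : ℕ) {ε : ℝ} (hε : 0 < ε) :
    IsProbabilityMeasure (wideGaussian d ε) :=
  isProbabilityMeasure_tilted (integrable_exp_mul_sq_norm_stdGaussian _ (by linarith))

/-- The logarithm of the normalizing constant of `wideGaussian`. -/
noncomputable def wideConst (d : ℕ) (ε : ℝ) : ℝ≥0∞ :=
  ENNReal.ofReal (Real.log (∫ x : EuclideanSpace ℝ (Fin d), Real.exp ((1 - ε) / 2 * ‖x‖ ^ 2)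
    ∂(stdGaussian (EuclideanSpace ℝ (Fin d)))))

lemma klDiv_add_wideConst {d : ℕ} {ε : ℝ} (hε : 0 < ε) (hε1 : ε ≤ 1)
    (Q : Measure (EuclideanSpace ℝ (Fin d))) [IsProbabilityMeasure Q]
    (hm : ∫⁻ x, ‖x‖ₑ ^ 2 ∂Q ≠ ∞) :
    klDiv Q (stdGaussian (EuclideanSpace ℝ (Fin d))) + wideConst d ε =
      klDiv Q (wideGaussian d ε) + ENNReal.ofReal ((1 - ε) / 2) * ∫⁻ x, ‖x‖ₑ ^ 2 ∂Q := by
  have hc : 0 ≤ (1 - ε) / 2 := by linarith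
  have hf0 : ∀ x : EuclideanSpace ℝ (Fin d), 0 ≤ (1 - ε) / 2 * ‖x‖ ^ 2 := fun x ↦ by positivity
  rw [← lintegral_ofReal_mul_norm_sq hc]
  refine klDiv_add_log_eq_klDiv_tilted_add hf0 ?_
    (integrable_exp_mul_sq_norm_stdGaussian _ (by linarith))
  rw [← lintegral_ofReal_ne_top_iff_integrable (by fun_prop) (ae_of_all _ hf0),
    lintegral_ofReal_mul_norm_sq hc]
  exact ENNReal.mul_ne_top ENNReal.ofReal_ne_top hm

/-- The lower semicontinuous part of `g_δ`. -/
noncomputable def lscPart (PV : Measure 𝒱) (A : 𝒱 → Matrix (Fin dY) (Fin dX) ℝ) (s δ ε : ℝ)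
    (Q : Measure (EuclideanSpace ℝ (Fin dX))) : ℝ≥0∞ :=
  ENNReal.ofReal s * klDiv Q (wideGaussian dX ε) + quadExcess PV A s Q + outputDeficit PV A δ Q

lemma lscPart_le_liminf (hA : ∀ i j, Measurable fun v ↦ A v i j)
    (hA1 : ∀ v, ‖A v‖ ≤ 1) {s : ℝ} (hs : sStar PV A ≤ s) {δ : ℝ} (hδ : 0 < δ) {ε : ℝ} (hε : 0 < ε)
    {Q : ℕ → ProbabilityMeasure (EuclideanSpace ℝ (Fin dX))}
    {Qstar : ProbabilityMeasure (EuclideanSpace ℝ (Fin dX))} (hQ : Tendsto Q atTop (𝓝 Qstar)) :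
    lscPart PV A s δ ε (Qstar : Measure _) ≤
      liminf (fun i ↦ lscPart PV A s δ ε (Q i : Measure _)) atTop := by
  have := isProbabilityMeasure_wideGaussian dX hε
  have h1 : ENNReal.ofReal s * klDiv (Qstar : Measure _) (wideGaussian dX ε) ≤
      liminf (fun i ↦ ENNReal.ofReal s * klDiv (Q i : Measure _) (wideGaussian dX ε)) atTop :=
    (mul_le_mul_right (klDiv_le_liminf_klDiv hQ _) _).trans
      (ennreal_mul_liminf_le ENNReal.ofReal_ne_top _)
  exact (add_le_add ((add_le_add h1 (quadExcess_le_liminf hs hQ)).trans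
    (ennreal_liminf_add_liminf_le _ _)) (outputDeficit_le_liminf hA hA1 hδ hQ)).trans
    (ennreal_liminf_add_liminf_le _ _)

/-- The constant separating `g_δ` from its lower semicontinuous part. -/
noncomputable def lscConst (PV : Measure 𝒱) (A : 𝒱 → Matrix (Fin dY) (Fin dX) ℝ) (s δ ε : ℝ) :
    ℝ≥0∞ :=
  ENNReal.ofReal s * wideConst dX ε + noiseConst PV A δ

lemma lscConst_ne_top (hA1 : ∀ v, ‖A v‖ ≤ 1) (s δ ε : ℝ) : lscConst PV A s δ ε ≠ ∞ :=
  ENNReal.add_ne_top.2 ⟨ENNReal.mul_ne_top ENNReal.ofReal_ne_top ENNReal.ofReal_ne_top,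
    noiseConst_ne_top hA1 δ⟩

/-- The bookkeeping identity: the second moment released by the tilt, completed by the `ε`-term, is
exactly what the quadratic excess and the output divergence consume. -/
lemma mul_klDiv_add_eq_lscPart_add (hA : ∀ i j, Measurable fun v ↦ A v i j)
    (hA1 : ∀ v, ‖A v‖ ≤ 1) {s : ℝ} (hs : sStar PV A ≤ s) {δ : ℝ} (hδ : 0 < δ) {ε : ℝ} (hε : 0 < ε)
    (hε1 : ε ≤ 1) (Q : Measure (EuclideanSpace ℝ (Fin dX))) [IsProbabilityMeasure Q]
    (hm : ∫⁻ x, ‖x‖ₑ ^ 2 ∂Q ≠ ∞) :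
    ENNReal.ofReal s * klDiv Q (stdGaussian (EuclideanSpace ℝ (Fin dX))) +
        (lscConst PV A s δ ε + ENNReal.ofReal (s / 2 * ε) * ∫⁻ x, ‖x‖ₑ ^ 2 ∂Q) =
      lscPart PV A s δ ε Q + outputDiv PV A δ Q := by
  have hs0 : 0 ≤ s := (norm_nonneg _).trans hs
  have h1 := klDiv_add_wideConst hε hε1 Q hm
  have h2 := quadExcess_add hA hA1 hs Q
  have h3 := outputDiv_add_outputDeficit (PV := PV) hA hA1 hδ Q
  have h4 : ENNReal.ofReal (s / 2) =
      ENNReal.ofReal s * ENNReal.ofReal ((1 - ε) / 2) + ENNReal.ofReal (s / 2 * ε) := by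
    rw [← ENNReal.ofReal_mul hs0, ← ENNReal.ofReal_add (by nlinarith) (by positivity)]
    congr 1
    ring
  rw [h4] at h2
  set m := ∫⁻ x, ‖x‖ₑ ^ 2 ∂Q
  calc _ = ENNReal.ofReal s * (klDiv Q (stdGaussian (EuclideanSpace ℝ (Fin dX))) +
        wideConst dX ε) + noiseConst PV A δ + ENNReal.ofReal (s / 2 * ε) * m := by
        rw [lscConst]; ring
    _ = ENNReal.ofReal s * klDiv Q (wideGaussian dX ε) +
        ((ENNReal.ofReal s * ENNReal.ofReal ((1 - ε) / 2) + ENNReal.ofReal (s / 2 * ε)) * m) +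
        noiseConst PV A δ := by rw [h1]; ring
    _ = ENNReal.ofReal s * klDiv Q (wideGaussian dX ε) + quadExcess PV A s Q +
        (noiseConst PV A δ + 2⁻¹ * ∫⁻ x, ENNReal.ofReal (meanQuad PV A x) ∂Q) := by
        rw [← h2]; ring
    _ = _ := by rw [← h3, lscPart]; ring

/-- Divergence and deficit are both nonnegative, and their sum is finite once the input has a finite
second moment. -/
lemma outputDiv_ne_top (hA : ∀ i j, Measurable fun v ↦ A v i j)
    (hA1 : ∀ v, ‖A v‖ ≤ 1) {s : ℝ} (hs : sStar PV A ≤ s) {δ : ℝ} (hδ : 0 < δ)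
    (Q : Measure (EuclideanSpace ℝ (Fin dX))) [IsProbabilityMeasure Q]
    (hm : ∫⁻ x, ‖x‖ₑ ^ 2 ∂Q ≠ ∞) : outputDiv PV A δ Q ≠ ∞ := by
  have h1 : quadExcess PV A s Q + 2⁻¹ * ∫⁻ x, ENNReal.ofReal (meanQuad PV A x) ∂Q ≠ ∞ := by
    rw [quadExcess_add hA hA1 hs Q]
    exact ENNReal.mul_ne_top ENNReal.ofReal_ne_top hm
  have h2 : outputDiv PV A δ Q + outputDeficit PV A δ Q ≠ ∞ := by
    rw [outputDiv_add_outputDeficit hA hA1 hδ Q]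
    exact ENNReal.add_ne_top.2 ⟨noiseConst_ne_top hA1 δ, (ENNReal.add_ne_top.1 h1).2⟩
  exact (ENNReal.add_ne_top.1 h2).1

lemma gDelta_eq_lscPart_sub (hA : ∀ i j, Measurable fun v ↦ A v i j)
    (hA1 : ∀ v, ‖A v‖ ≤ 1) {s : ℝ} (hs : sStar PV A ≤ s) {δ : ℝ} (hδ : 0 < δ) {ε : ℝ} (hε : 0 < ε)
    (hε1 : ε ≤ 1) (Q : Measure (EuclideanSpace ℝ (Fin dX))) [IsProbabilityMeasure Q]
    (hm : ∫⁻ x, ‖x‖ₑ ^ 2 ∂Q ≠ ∞) :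
    gDelta PV A s δ Q = (lscPart PV A s δ ε Q : EReal) -
      (((lscConst PV A s δ ε).toReal + s / 2 * ε * (∫⁻ x, ‖x‖ₑ ^ 2 ∂Q).toReal : ℝ) : EReal) := by
  have hs0 : 0 ≤ s := (norm_nonneg _).trans hs
  have hne : ENNReal.ofReal (s / 2 * ε) * ∫⁻ x, ‖x‖ₑ ^ 2 ∂Q ≠ ∞ :=
    ENNReal.mul_ne_top ENNReal.ofReal_ne_top hm
  have h := ereal_sub_eq_sub_of_add_eq_add
    (ENNReal.add_ne_top.2 ⟨lscConst_ne_top hA1 s δ ε, hne⟩) (outputDiv_ne_top hA hA1 hs hδ Q hm)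
    (mul_klDiv_add_eq_lscPart_add hA hA1 hs hδ hε hε1 Q hm)
  rw [ENNReal.toReal_add (lscConst_ne_top hA1 s δ ε) hne, ENNReal.toReal_mul,
    ENNReal.toReal_ofReal (by positivity), EReal.coe_ennreal_mul, EReal.coe_ennreal_ofReal,
    max_eq_left hs0] at h
  exact h

end Decomposition

end SmoothedFunctional

open SmoothedFunctional in
theorem mainTheorem5 {𝒱 : Type*} [MeasurableSpace 𝒱] (PV : Measure 𝒱) [IsProbabilityMeasure PV]
    (dX dY : ℕ) (A : 𝒱 → Matrix (Fin dY) (Fin dX) ℝ)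
    (hA_meas : ∀ i j, Measurable fun v => A v i j) (hA_norm : ∀ v, ‖A v‖ ≤ 1)
    (s : ℝ) (hs : SmoothedFunctional.sStar PV A ≤ s) (δ : ℝ) (hδ : 0 < δ)
    (Q : ℕ → ProbabilityMeasure (EuclideanSpace ℝ (Fin dX)))
    (Qstar : ProbabilityMeasure (EuclideanSpace ℝ (Fin dX)))
    (hQ : Tendsto Q atTop (𝓝 Qstar))
    (b : ℝ) (hb : 0 < b)
    (hmoment : ∀ i, ∫⁻ x, ‖x‖ₑ ^ 2 ∂(Q i : Measure (EuclideanSpace ℝ (Fin dX))) <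
      ENNReal.ofReal b) :
    SmoothedFunctional.gDelta PV A s δ (Qstar : Measure (EuclideanSpace ℝ (Fin dX))) ≤
      liminf (fun i => SmoothedFunctional.gDelta PV A s δ
        (Q i : Measure (EuclideanSpace ℝ (Fin dX)))) atTop := by
  have hs0 : 0 ≤ s := (norm_nonneg _).trans hs
  have hmi : ∀ i, ∫⁻ x, ‖x‖ₑ ^ 2 ∂(Q i : Measure (EuclideanSpace ℝ (Fin dX))) ≠ ∞ :=
    fun i ↦ ((hmoment i).trans ENNReal.ofReal_lt_top).ne
  -- Second moments are weakly lower semicontinuous, so the limit inherits the bound and the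
  -- decomposition applies to it too.
  have hmstar : ∫⁻ x, ‖x‖ₑ ^ 2 ∂(Qstar : Measure (EuclideanSpace ℝ (Fin dX))) ≠ ∞ := by
    refine ne_top_of_le_ne_top ENNReal.ofReal_ne_top ((lintegral_enorm_sq_le_liminf hQ).trans
      (liminf_le_of_frequently_le' (x := ENNReal.ofReal b) ?_))
    exact Frequently.of_forall fun i ↦ (hmoment i).le
  -- The leftover moment term lies in `[0, s / 2 * ε * b]`: its lower bound is used at the limit and
  -- its upper bound along the sequence, at a total cost of `s / 2 * b * ε`.
  refine ereal_le_of_forall_sub_le (c := s / 2 * b) fun ε hε hε1 ↦ ?_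
  set κ := (lscConst PV A s δ ε).toReal
  have hcont : Continuous fun x : ℝ≥0∞ ↦ (x : EReal) + ((-(κ + s / 2 * ε * b) : ℝ) : EReal) := by
    refine continuous_iff_continuousAt.2 fun x ↦ ?_
    exact ContinuousAt.comp (f := fun x : ℝ≥0∞ ↦ ((x : EReal), ((-(κ + s / 2 * ε * b) : ℝ) : EReal)))
      (EReal.continuousAt_add (Or.inr (EReal.coe_ne_bot _)) (Or.inr (EReal.coe_ne_top _)))
      (continuous_coe_ennreal_ereal.prodMk continuous_const).continuousAt
  have hmono : Monotone fun x : ℝ≥0∞ ↦ (x : EReal) + ((-(κ + s / 2 * ε * b) : ℝ) : EReal) :=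
    fun x y hxy ↦ add_le_add_left (EReal.coe_ennreal_le_coe_ennreal_iff.2 hxy) _
  have hlsc := hmono (lscPart_le_liminf (PV := PV) hA_meas hA_norm hs hδ hε hQ)
  simp only at hlsc
  rw [hmono.map_liminf_of_continuousAt _ hcont.continuousAt] at hlsc
  refine le_trans ?_ (hlsc.trans (liminf_le_liminf (Eventually.of_forall fun i ↦ ?_)))
  · rw [gDelta_eq_lscPart_sub hA_meas hA_norm hs hδ hε hε1 _ hmstar, sub_eq_add_neg,
      sub_eq_add_neg, add_assoc, ← EReal.coe_neg, ← EReal.coe_neg, ← EReal.coe_add]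
    refine add_le_add_right (EReal.coe_le_coe_iff.2 ?_) _
    have : 0 ≤ s / 2 * ε *
        (∫⁻ x, ‖x‖ₑ ^ 2 ∂(Qstar : Measure (EuclideanSpace ℝ (Fin dX)))).toReal := by positivity
    linarith
  · rw [gDelta_eq_lscPart_sub hA_meas hA_norm hs hδ hε hε1 _ (hmi i), sub_eq_add_neg,
      ← EReal.coe_neg]
    refine add_le_add_right (EReal.coe_le_coe_iff.2 (neg_le_neg ?_)) _
    have : (∫⁻ x, ‖x‖ₑ ^ 2 ∂(Q i : Measure (EuclideanSpace ℝ (Fin dX)))).toReal ≤ b :=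
      ENNReal.toReal_le_of_le_ofReal hb.le (hmoment i).le
    gcongr
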